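/- An octagon is a cyclically labeled sequence $P=(p_i)_{i\in\mathbb Z/8}$ of points of the real projective plane $\mathbb{RP}^2\supset\mathbb R^2$. It is convex if some projective transformation maps its vertices to the successive vertices of a (strictly) convex octagon in the affine plane $\mathbb R^2$. The $3$-diagonal map $T_3$ is the partially defined map sending $P$ to the octagon obtained by intersecting successive $3$-diagonals, $T_3(P)_i=\overline{p_ip_{i+3}}\cap\overline{p_{i+1}p_{i+4}}$; its inverse is given by $T_3^{-1}(Q)_i=\overline{q_{i-1}q_i}\cap\overline{q_{i-4}q_{i-3}}$. Given $P_0$, put $P_j=T_3^{\,j}(P_0)$ for $j\in\mathbb Z$; the assertion "$P_j$ is convex" includes that $P_j$ is defined. Theorem. Let $P_0$ be an octagon with $4$-fold rotational symmetry, i.e. a Euclidean rotation by $\pi/2$ about some point of $\mathbb R^2$ maps $P_0$ to itself, shifting the vertex labels by $2$ or by $-2$. Then $P_0$ is a regular (convex) octagon if and only if $P_j$ is convex for all $j\in\mathbb Z$. More precisely: 1. $P_0$ is convex and has $8$-fold dihedral symmetry (a Euclidean dihedral symmetry group of order $8$), with symmetry lines containing the vertices, if and only if $P_j$ is convex for all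 $j\ge 0$. 2. $P_0$ is convex and has $8$-fold dihedral symmetry, with symmetry lines bisecting the edges, if and only if $P_j$ is convex for all $j\le 0$. -/

import Mathlib

open scoped LinearAlgebra.Projectivization MatrixGroups

noncomputable section

namespace Pentagram

/-- The real projective plane: lines through the origin of `ℝ³`. By duality a line of the
plane is also written as a point `[a : b : c]`, meaning the line `a x + b y + c z = 0`. -/
abbrev RP2 : Type := ℙ ℝ (Fin 3 → ℝ)

/-- The point `[x : y : 1]` of the standard affine patch. -/
def affinePoint (x y : ℝ) : RP2 :=
  Projectivization.mk ℝ ![x, y, 1] (fun h => one_ne_zero (congrFun h 2))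

/-- A (labeled) octagon in the projective plane, given by its cyclic sequence of vertices. -/
abbrev Octagon : Type := ZMod 8 → RP2

/-! ### The 3-diagonal map and its orbits -/

/-- The line through two distinct points; equally, the common point of two distinct lines.
It is represented by the cross product, and is only used for distinct arguments. -/
def join (p q : RP2) : RP2 := Projectivization.cross p q

/-- The `i`-th 3-diagonal: the line through the vertices `i` and `i + 3`. -/
def diagonal (P : Octagon) (i : ZMod 8) : RP2 := join (P i) (P (i + 3))

/-- The line extending the edge from vertex `i - 1` to vertex `i`. -/
def edgeLine (P : Octagon) (i : ZMod 8) : RP2 := join (P (i - 1)) (P i)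

/-- The 3-diagonal map: successive 3-diagonals are intersected. It is a partial map, defined
when the 3-diagonals are well defined and successive ones are distinct. -/
def T3 : Octagon →. Octagon := fun P =>
  { Dom := ∀ i, P i ≠ P (i + 3) ∧ diagonal P i ≠ diagonal P (i + 1)
    get := fun _ i => join (diagonal P i) (diagonal P (i + 1)) }

/-- The inverse of the 3-diagonal map. The vertices `i - 1` and `i` of `Q = T3 P` lie on the
3-diagonal of `P` from vertex `i` to vertex `i + 3`; so that diagonal is `edgeLine Q i`, and
the `i`-th vertex of `P` is the intersection of `edgeLine Q i` and `edgeLine Q (i - 3)`. -/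
def T3Inv : Octagon →. Octagon := fun Q =>
  { Dom := ∀ i, Q (i - 1) ≠ Q i ∧ edgeLine Q i ≠ edgeLine Q (i - 3)
    get := fun _ i => join (edgeLine Q i) (edgeLine Q (i - 3)) }

/-- The orbit `P_j = T3 ^ j (P)`, `j ∈ ℤ`; each `P_j` may be undefined. -/
def orbit (P : Octagon) : ℤ → Part Octagon
  | .ofNat n => (fun Q => Q.bind T3)^[n] (Part.some P)
  | .negSucc n => (fun Q => Q.bind T3Inv)^[n + 1] (Part.some P)

/-! ### Convexity -/

/-- The points `(x i, y i)` are, in this cyclic order, the vertices of a (strictly) convex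
octagon of the affine plane, listed counterclockwise: all vertices off an edge lie strictly to
the left of that edge. -/
def IsAffineConvex (x y : ZMod 8 → ℝ) : Prop :=
  ∀ i j, j ≠ i → j ≠ i + 1 →
    0 < (x (i + 1) - x i) * (y j - y i) - (y (i + 1) - y i) * (x j - x i)

/-- An octagon is convex if some projective transformation carries it to a convex octagon of
the standard affine patch. (The latter may be taken counterclockwise, since reflections of the
affine plane are projective transformations.) -/
def IsConvex (P : Octagon) : Prop :=
  ∃ (g : GL (Fin 3) ℝ) (x y : ZMod 8 → ℝ),
    (∀ i, g • P i = affinePoint (x i) (y i)) ∧ IsAffineConvex x y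

/-- The `j`-th octagon of the orbit of `P` is defined and convex. -/
def OrbitConvexAt (P : Octagon) (j : ℤ) : Prop :=
  ∃ Q ∈ orbit P j, IsConvex Q

/-! ### Euclidean symmetries -/

/-- The counterclockwise rotation by `π / 2` about `(a, b)`, acting on the projective plane. -/
def quarterTurn (a b : ℝ) : GL (Fin 3) ℝ :=
  Matrix.GeneralLinearGroup.mkOfDetNeZero
    !![0, -1, a + b; 1, 0, b - a; 0, 0, 1] (by simp [Matrix.det_fin_three])

/-- The reflection in the line through `(a, b)` with direction `(cos φ, sin φ)`, acting on the
projective plane. -/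
def reflection (a b φ : ℝ) : GL (Fin 3) ℝ :=
  Matrix.GeneralLinearGroup.mkOfDetNeZero
    !![Real.cos (2 * φ), Real.sin (2 * φ), a - Real.cos (2 * φ) * a - Real.sin (2 * φ) * b;
       Real.sin (2 * φ), -Real.cos (2 * φ), b - Real.sin (2 * φ) * a + Real.cos (2 * φ) * b;
       0, 0, 1] (by
    have h := Real.sin_sq_add_cos_sq (2 * φ)
    simp only [Matrix.det_fin_three, Matrix.of_apply, Matrix.cons_val]
    nlinarith)

/-- The point `p` lies on the line through `(a, b)` with direction `(cos φ, sin φ)`. -/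
def OnAxis (a b φ : ℝ) (p : RP2) : Prop :=
  ∀ v ∈ p.submodule,
    (v 0 - a * v 2) * Real.sin φ - (v 1 - b * v 2) * Real.cos φ = 0

/-- A quarter turn about `(a, b)` maps the octagon to itself, advancing the vertices by two
(in one of the two senses). -/
def HasQuarterTurnSymmetry (P : Octagon) (a b : ℝ) : Prop :=
  (∀ i, quarterTurn a b • P i = P (i + 2)) ∨ (∀ i, quarterTurn a b • P i = P (i - 2))

/-- 4-fold rotational symmetry, about some point of the affine plane. -/
def HasFourFoldSymmetry (P : Octagon) : Prop :=
  ∃ a b, HasQuarterTurnSymmetry P a b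

/-- The line through `(a, b)` with direction `(cos φ, sin φ)` contains two opposite vertices of
the octagon, and the reflection in it is a symmetry of the octagon fixing these vertices. -/
def IsVertexSymmetryLine (P : Octagon) (a b φ : ℝ) : Prop :=
  ∃ j, OnAxis a b φ (P j) ∧ OnAxis a b φ (P (j + 4)) ∧
    ∀ i, reflection a b φ • P (j + i) = P (j - i)

/-- The reflection in the line through `(a, b)` with direction `(cos φ, sin φ)` is a symmetry of
the octagon that swaps the two ends of an edge (hence also those of the opposite edge), so that
the line bisects these edges. -/
def IsEdgeSymmetryLine (P : Octagon) (a b φ : ℝ) : Prop :=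
  ∃ j, ∀ i, reflection a b φ • P (j + i) = P (j + 1 - i)

/-- Symmetry under a dihedral group of order eight (generated by a quarter turn and a
reflection), whose four symmetry lines, at angles `π / 4`, all pass through vertices. -/
def HasVertexDihedralSymmetry (P : Octagon) : Prop :=
  ∃ a b φ, HasQuarterTurnSymmetry P a b ∧
    ∀ k : Fin 4, IsVertexSymmetryLine P a b (φ + k * (Real.pi / 4))

/-- Symmetry under a dihedral group of order eight (generated by a quarter turn and a
reflection), whose four symmetry lines, at angles `π / 4`, all bisect edges. -/
def HasEdgeDihedralSymmetry (P : Octagon) : Prop :=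
  ∃ a b φ, HasQuarterTurnSymmetry P a b ∧
    ∀ k : Fin 4, IsEdgeSymmetryLine P a b (φ + k * (Real.pi / 4))

/-- A regular octagon of the affine plane: center `(a, b)`, radius `r > 0`, and successive
vertices at angle `π / 4`, counterclockwise (`ε = 1`) or clockwise (`ε = -1`). -/
def IsRegular (P : Octagon) : Prop :=
  ∃ a b r θ ε : ℝ, 0 < r ∧ (ε = 1 ∨ ε = -1) ∧
    ∀ i : ZMod 8, P i = affinePoint (a + r * Real.cos (θ + ε * (i.val * (Real.pi / 4))))
      (b + r * Real.sin (θ + ε * (i.val * (Real.pi / 4))))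

end Pentagram

end

noncomputable section

namespace Pentagram

/-! ### The dynamics of the 3-diagonal map on the parameter plane -/

/-! An octagon with 4-fold symmetry is, up to similarity, `1, z, i, iz, -1, ...` with `z = a + ib`,
so the 3-diagonal map becomes a map `nextParam` of the plane. Convexity confines `z` to the open
half disc with diameter from `1` to `i`, on the side away from the origin. In terms of `S = a + b`
and `d = a - b`, the asymmetry evolves by `d ↦ -d L² / M` with `L² = M + 4 (S² - d²) (1 + S)`, and
`S² - d² = 4ab` is positive on this half disc. Thus `|d|` grows, while convexity bounds it by `1`.

The growth is uniform. If `|d| ≥ 1/2`, the next asymmetry is at least `1` and the next octagon is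
not convex (`one_le_growth`); otherwise `|d|` grows by a factor of at least `6/5`
(`growth_of_lt_half`). Hence an orbit convex for all `j ≥ 0` has `d = 0`. Conversely the line `d =
0` is invariant and convexity persists on it (`ConvexParam.nextParam_of_eq`). This line is the locus
of octagons with symmetry lines through the vertices.

Backward orbits reduce to forward ones by projective duality: on the octagon of edge lines, the
inverse map acts as the 3-diagonal map up to relabeling (`exists_mem_T3Inv`). Duality turns the
condition `d = 0` into `|z| = 1` (`HasParam.dual`), the locus of octagons with symmetry lines
bisecting the edges. The two loci meet within the half disc only at `z = exp(iπ/4)`, the regular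
octagon. -/

/-- The parameters `(a, b)` for which the octagon `1, z, i, iz, -1, ...`, `z = a + i b`,
is convex. -/
def ConvexParam (x : ℝ × ℝ) : Prop :=
  1 < x.1 + x.2 ∧ x.1 ^ 2 + x.2 ^ 2 < x.1 + x.2

/-- The action of the 3-diagonal map on `x.1 + x.2`. -/
def nextSum (x : ℝ × ℝ) : ℝ :=
  let S := x.1 + x.2
  let d := x.1 - x.2
  (S ^ 2 + d ^ 2 + 2 * S) * ((S ^ 2 - d ^ 2) * (S + d ^ 2) - 2 * (d * (1 + S)) ^ 2) /
    ((1 + S) * (4 * d ^ 2 * (S + 1) ^ 2 + (S ^ 2 - d ^ 2) ^ 2))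

/-- The action of the 3-diagonal map on `x.1 - x.2`. -/
def nextDiff (x : ℝ × ℝ) : ℝ :=
  let S := x.1 + x.2
  let d := x.1 - x.2
  (-d) * (S ^ 2 + d ^ 2 + 2 * S) ^ 2 / (4 * d ^ 2 * (S + 1) ^ 2 + (S ^ 2 - d ^ 2) ^ 2)

/-- The action of the 3-diagonal map on the parameters of an octagon. -/
def nextParam (x : ℝ × ℝ) : ℝ × ℝ :=
  ((nextSum x + nextDiff x) / 2, (nextSum x - nextDiff x) / 2)

theorem nextParam_sub (x : ℝ × ℝ) : (nextParam x).1 - (nextParam x).2 = nextDiff x := by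
  simp only [nextParam]; ring

theorem ConvexParam.pos {x : ℝ × ℝ} (h : ConvexParam x) : 0 < x.1 ∧ 0 < x.2 := by
  obtain ⟨h1, h2⟩ := h
  constructor <;> nlinarith [sq_nonneg (x.1 - x.2)]

/-- The second inequality gives `d² = 2 (a² + b²) - S² < 1 - (S - 1)²`. -/
theorem ConvexParam.abs_lt_one {x : ℝ × ℝ} (h : ConvexParam x) : |x.1 - x.2| < 1 := by
  obtain ⟨h1, h2⟩ := h
  rw [abs_lt]
  constructor <;> nlinarith [sq_nonneg (x.1 + x.2 - 1)]

/-- With `e = |d|`, this says that an asymmetry of at least `1/2` becomes at least `1` after one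
step, which is incompatible with convexity. -/
theorem one_le_growth {S e : ℝ} (hS : 1 < S) (hS2 : S ≤ 2) (he : 1 / 2 ≤ e) (he1 : e < 1) :
    4 * e ^ 2 * (S + 1) ^ 2 + (S ^ 2 - e ^ 2) ^ 2 ≤ e * (S ^ 2 + e ^ 2 + 2 * S) ^ 2 := by
  obtain ⟨t, rfl⟩ : ∃ t, S = 1 + t := ⟨S - 1, by ring⟩
  have ht : 0 < t := by linarith
  have ht1 : t ≤ 1 := by linarith
  -- `B` is `F - e (1 - e) (2 + t)`. The difference of the two sides of the goal is `4 e (2 + t) B -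
  -- (1 - e) F ^ 2`, and both terms are compared with `(1 - e) ^ 2` and powers of `t`.
  set B := (1 - e) ^ 2 + t * (2 - e + e ^ 2) + t ^ 2 with hB
  set F := (1 + t) ^ 2 - e ^ 2 with hF
  have hF0 : 0 ≤ F := by nlinarith
  have hF1 : F ≤ (1 - e) * (1 + e) + 3 * t := by nlinarith
  have hF2 : F ^ 2 ≤ 8 * (1 - e) ^ 2 + 18 * t ^ 2 := by
    have h1 : F ≤ 2 * (1 - e) + 3 * t := by nlinarith
    nlinarith [sq_nonneg (2 * (1 - e) - 3 * t)]
  have hF3 : (1 - e) * F ^ 2 ≤ 4 * (1 - e) ^ 2 + 9 * t ^ 2 := by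
    nlinarith [sq_nonneg F]
  have hB2 : (1 - e) ^ 2 + 7 / 4 * t + t ^ 2 ≤ B := by
    nlinarith [mul_nonneg ht.le (sq_nonneg (e - 1 / 2))]
  have hc : 4 ≤ 4 * e * (2 + t) := by nlinarith
  have hkey : (1 - e) * F ^ 2 ≤ 4 * e * (2 + t) * B := by
    have hB0 : 0 ≤ B := by nlinarith [sq_nonneg (1 - e)]
    nlinarith [mul_le_mul_of_nonneg_right hc hB0]
  have : e * ((1 + t) ^ 2 + e ^ 2 + 2 * (1 + t)) ^ 2
      - (4 * e ^ 2 * (1 + t + 1) ^ 2 + F ^ 2)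
      = 4 * e * (2 + t) * B - (1 - e) * F ^ 2 := by
    rw [hB, hF]; ring
  linarith

/-- The right side exceeds `M = 4 d² (S + 1)² + (S² - d²)²` by `4 (S² - d²) (1 + S)`. This excess is
at least `4 · 3/4 · 2 = 6`, while `M ≤ 25`, so it is more than `M / 5`. -/
theorem growth_of_lt_half {S d : ℝ} (hS : 1 < S) (hS2 : S ≤ 2) (hd : d ^ 2 ≤ 1 / 4) :
    6 / 5 * (4 * d ^ 2 * (S + 1) ^ 2 + (S ^ 2 - d ^ 2) ^ 2) ≤ (S ^ 2 + d ^ 2 + 2 * S) ^ 2 := by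
  have hF : 3 / 4 ≤ S ^ 2 - d ^ 2 := by nlinarith
  have hF4 : S ^ 2 - d ^ 2 ≤ 4 := by nlinarith [sq_nonneg d]
  have hM : 4 * d ^ 2 * (S + 1) ^ 2 + (S ^ 2 - d ^ 2) ^ 2 ≤ 25 := by
    have h1 : (S + 1) ^ 2 ≤ 9 := by nlinarith
    have h2 : d ^ 2 * (S + 1) ^ 2 ≤ 1 / 4 * 9 :=
      mul_le_mul hd h1 (sq_nonneg _) (by norm_num)
    nlinarith
  have h3 : (S ^ 2 + d ^ 2 + 2 * S) ^ 2 = 4 * d ^ 2 * (S + 1) ^ 2 + (S ^ 2 - d ^ 2) ^ 2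
      + 4 * (S ^ 2 - d ^ 2) * (1 + S) := by ring
  nlinarith

theorem growth_denom_pos {S d : ℝ} (hS : 1 < S) :
    0 < 4 * d ^ 2 * (S + 1) ^ 2 + (S ^ 2 - d ^ 2) ^ 2 := by
  rcases eq_or_ne d 0 with rfl | hd
  · have : 0 < S := by linarith
    ring_nf
    positivity
  · have : 0 < d ^ 2 := by positivity
    have : 0 < S + 1 := by linarith
    positivity

theorem ConvexParam.sum_le_two {x : ℝ × ℝ} (h : ConvexParam x) : x.1 + x.2 ≤ 2 := by
  obtain ⟨h1, h2⟩ := h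
  nlinarith [sq_nonneg (x.1 - x.2)]

/-- As long as the octagons stay convex, the asymmetry grows geometrically. -/
theorem ConvexParam.abs_nextDiff {x : ℝ × ℝ} (h : ConvexParam x)
    (h' : ConvexParam (nextParam x)) :
    6 / 5 * |x.1 - x.2| ≤ |(nextParam x).1 - (nextParam x).2| := by
  have hlt := h'.abs_lt_one
  rw [nextParam_sub] at *
  have hS2 := h.sum_le_two
  have hd1 := h.abs_lt_one
  have hS := h.1
  simp only [nextDiff] at *
  set S := x.1 + x.2
  set d := x.1 - x.2
  have hM := growth_denom_pos (d := d) hS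
  rw [abs_div, abs_mul, abs_neg, abs_of_pos hM, abs_pow, sq_abs] at hlt ⊢
  rw [div_lt_one hM] at hlt
  -- Otherwise the next asymmetry would be at least `1`, contrary to the convexity of the next
  -- octagon.
  have hhalf : |d| < 1 / 2 := by
    by_contra! hc
    have := one_le_growth hS hS2 hc hd1
    rw [sq_abs] at this
    linarith
  rw [le_div_iff₀ hM]
  have := growth_of_lt_half (d := d) hS hS2 (by rw [← sq_abs]; nlinarith [abs_nonneg d])
  nlinarith [abs_nonneg d]

theorem eq_of_forall_convexParam {x : ℝ × ℝ} (h : ∀ n, ConvexParam (nextParam^[n] x)) :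
    x.1 = x.2 := by
  have key : ∀ n : ℕ, (6 / 5 : ℝ) ^ n * |x.1 - x.2| ≤
      |(nextParam^[n] x).1 - (nextParam^[n] x).2| := by
    intro n
    induction n with
    | zero => simp
    | succ n ih =>
      have h1 := h (n + 1)
      rw [Function.iterate_succ_apply'] at h1 ⊢
      have := (h n).abs_nextDiff h1
      rw [pow_succ]
      linarith
  by_contra hne
  have hpos : 0 < |x.1 - x.2| := abs_pos.mpr (sub_ne_zero.mpr hne)
  obtain ⟨n, hn⟩ := pow_unbounded_of_one_lt (1 / |x.1 - x.2|) (by norm_num : (1 : ℝ) < 6 / 5)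
  rw [div_lt_iff₀ hpos] at hn
  linarith [key n, (h n).abs_lt_one]

/-- On the diagonal, convexity means `1/2 < a < 1`, and the map is the Möbius map `a ↦ (a + 1) / (1
+ 2a)`, which sends this interval into itself. -/
theorem ConvexParam.nextParam_of_eq {x : ℝ × ℝ} (h : ConvexParam x) (he : x.1 = x.2) :
    ConvexParam (nextParam x) ∧ (nextParam x).1 = (nextParam x).2 := by
  obtain ⟨a, b⟩ := x
  obtain rfl : a = b := he
  obtain ⟨h1, h2⟩ := h
  simp only at h1 h2
  have ha : 1 / 2 < a := by linarith
  have ha1 : a < 1 := by nlinarith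
  have hd : nextDiff (a, a) = 0 := by simp [nextDiff]
  have hs : nextSum (a, a) = 2 * ((a + 1) / (1 + 2 * a)) := by
    simp only [nextSum]
    have : 1 + 2 * a ≠ 0 := by positivity
    have : 1 + (a + a) ≠ 0 := by positivity
    have : a + a ≠ 0 := by positivity
    simp only [sub_self]
    field_simp
    ring
  have hp : nextParam (a, a) = ((a + 1) / (1 + 2 * a), (a + 1) / (1 + 2 * a)) := by
    simp only [nextParam, hd, hs]; ext <;> ring
  rw [hp]
  refine ⟨?_, rfl⟩
  have hp1 : 1 / 2 < (a + 1) / (1 + 2 * a) := by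
    rw [lt_div_iff₀ (by positivity)]; linarith
  have hp2 : (a + 1) / (1 + 2 * a) < 1 := by
    rw [div_lt_iff₀ (by positivity)]; linarith
  constructor <;> simp only <;> nlinarith

theorem ConvexParam.iterate_of_eq {x : ℝ × ℝ} (h : ConvexParam x) (he : x.1 = x.2) (n : ℕ) :
    ConvexParam (nextParam^[n] x) ∧ (nextParam^[n] x).1 = (nextParam^[n] x).2 := by
  induction n with
  | zero => exact ⟨h, he⟩
  | succ n ih =>
    rw [Function.iterate_succ_apply']
    exact ih.1.nextParam_of_eq ih.2

open Matrix

/-! ### Homogeneous coordinates -/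

/-- `v` is a vector of homogeneous coordinates of the point `p`. -/
def IsRep (p : RP2) (v : Fin 3 → ℝ) : Prop :=
  ∃ h : v ≠ 0, p = Projectivization.mk ℝ v h

theorem IsRep.eq {p q : RP2} {v w : Fin 3 → ℝ} (hp : IsRep p v) (hq : IsRep q w) (c : ℝ)
    (h : v = c • w) : p = q := by
  obtain ⟨hv, rfl⟩ := hp
  obtain ⟨hw, rfl⟩ := hq
  rw [Projectivization.mk_eq_mk_iff']
  exact ⟨c, h.symm⟩

theorem IsRep.exists_smul {p : RP2} {v w : Fin 3 → ℝ} (hv : IsRep p v) (hw : IsRep p w) :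
    ∃ c : ℝ, c ≠ 0 ∧ v = c • w := by
  obtain ⟨hv, h⟩ := hv
  obtain ⟨hw, rfl⟩ := hw
  obtain ⟨c, hc⟩ := (Projectivization.mk_eq_mk_iff' ℝ _ _ hv hw).1 h.symm
  refine ⟨c, ?_, hc.symm⟩
  rintro rfl
  exact hv (by simpa using hc.symm)

theorem isRep_rep (p : RP2) : IsRep p p.rep := ⟨p.rep_nonzero, p.mk_rep.symm⟩

theorem IsRep.smul {p : RP2} {v : Fin 3 → ℝ} (h : IsRep p v) {c : ℝ} (hc : c ≠ 0) :
    IsRep p (c • v) := by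
  obtain ⟨hv, rfl⟩ := h
  refine ⟨smul_ne_zero hc hv, ?_⟩
  rw [Projectivization.mk_eq_mk_iff']
  exact ⟨c⁻¹, by simp [smul_smul, hc]⟩

theorem isRep_affinePoint (x y : ℝ) : IsRep (affinePoint x y) ![x, y, 1] := ⟨_, rfl⟩

theorem IsRep.gl_smul {p : RP2} {v : Fin 3 → ℝ} (h : IsRep p v) (g : GL (Fin 3) ℝ) :
    IsRep (g • p) ((g : Matrix (Fin 3) (Fin 3) ℝ) *ᵥ v) := by
  obtain ⟨hv, rfl⟩ := h
  exact ⟨_, rfl⟩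

theorem IsRep.ne_iff {p q : RP2} {v w : Fin 3 → ℝ} (hp : IsRep p v) (hq : IsRep q w) :
    p ≠ q ↔ crossProduct v w ≠ 0 := by
  obtain ⟨hv, rfl⟩ := hp
  obtain ⟨hw, rfl⟩ := hq
  exact (Projectivization.mk_eq_mk_iff_crossProduct_eq_zero hv hw).not

theorem IsRep.join {p q : RP2} {v w : Fin 3 → ℝ} (hp : IsRep p v) (hq : IsRep q w)
    (h : crossProduct v w ≠ 0) : IsRep (join p q) (crossProduct v w) := by
  obtain ⟨hv, rfl⟩ := hp
  obtain ⟨hw, rfl⟩ := hq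
  exact ⟨h, Projectivization.cross_mk_of_cross_ne_zero hv hw h⟩

theorem affinePoint_inj {x y x' y' : ℝ} :
    affinePoint x y = affinePoint x' y' ↔ x = x' ∧ y = y' := by
  refine ⟨fun h => ?_, fun h => by rw [h.1, h.2]⟩
  have h1 := isRep_affinePoint x y
  rw [h] at h1
  obtain ⟨c, -, hc⟩ := h1.exists_smul (isRep_affinePoint x' y')
  have h0 := congrFun hc 0
  have h1 := congrFun hc 1
  have h2 := congrFun hc 2
  simp at h0 h1 h2
  subst h2
  simpa using And.intro h0 h1

theorem cross_mulVec (M : Matrix (Fin 3) (Fin 3) ℝ) (v w : Fin 3 → ℝ) :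
    crossProduct (M *ᵥ v) (M *ᵥ w) = M.adjugateᵀ *ᵥ crossProduct v w := by
  ext i
  fin_cases i <;>
    simp [cross_apply, adjugate_fin_three, mulVec, dotProduct, Fin.sum_univ_three] <;> ring

/-- The action of a projective transformation on lines. -/
def contragredient (g : GL (Fin 3) ℝ) : GL (Fin 3) ℝ :=
  GeneralLinearGroup.mkOfDetNeZero (g : Matrix (Fin 3) (Fin 3) ℝ).adjugateᵀ (by
    rw [det_transpose, det_adjugate]
    exact pow_ne_zero _ (GeneralLinearGroup.det_ne_zero g))

theorem join_smul (g : GL (Fin 3) ℝ) {p q : RP2} (h : p ≠ q) :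
    join (g • p) (g • q) = contragredient g • join p q := by
  have hp := isRep_rep p
  have hq := isRep_rep q
  have hc := (hp.ne_iff hq).1 h
  have hc' := ((hp.gl_smul g).ne_iff (hq.gl_smul g)).1 (by simpa using h)
  refine ((hp.gl_smul g).join (hq.gl_smul g) hc').eq ((hp.join hq hc).gl_smul _) 1 ?_
  rw [one_smul, cross_mulVec]
  rfl

/-- For a 3×3 matrix the double adjugate is the determinant times the matrix, which is the same
projective map. -/
theorem contragredient_contragredient_smul (g : GL (Fin 3) ℝ) (p : RP2) :
    contragredient (contragredient g) • p = g • p := by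
  refine ((isRep_rep p).gl_smul _).eq ((isRep_rep p).gl_smul g)
    (g : Matrix (Fin 3) (Fin 3) ℝ).det ?_
  rw [← smul_mulVec]
  congr 1
  change (g : Matrix (Fin 3) (Fin 3) ℝ).adjugateᵀ.adjugateᵀ = _
  rw [← adjugate_transpose, transpose_transpose, adjugate_adjugate _ (by simp)]
  simp

theorem join_join_smul (g : GL (Fin 3) ℝ) {p q r s : RP2} (h : p ≠ q) (h' : r ≠ s)
    (hl : join p q ≠ join r s) :
    join (join (g • p) (g • q)) (join (g • r) (g • s)) = g • join (join p q) (join r s) := by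
  rw [join_smul g h, join_smul g h', join_smul _ hl, contragredient_contragredient_smul]

/-- Two lines through a point meet in that point. -/
theorem join_join_eq {p q r : RP2} (h : p ≠ q) (h' : q ≠ r) (hl : join p q ≠ join q r) :
    join (join p q) (join q r) = q := by
  have hp := isRep_rep p
  have hq := isRep_rep q
  have hr := isRep_rep r
  have h1 := hp.join hq ((hp.ne_iff hq).1 h)
  have h2 := hq.join hr ((hq.ne_iff hr).1 h')
  refine (h1.join h2 ((h1.ne_iff h2).1 hl)).eq hq (p.rep ⬝ᵥ crossProduct q.rep r.rep) ?_
  ext i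
  fin_cases i <;> simp [cross_apply, dotProduct, Fin.sum_univ_three] <;> ring

theorem join_comm (p q : RP2) : join p q = join q p := Projectivization.cross_comm p q

/-- The determinant of three vectors. -/
def triple (u v w : Fin 3 → ℝ) : ℝ := u ⬝ᵥ crossProduct v w

theorem triple_mulVec (M : Matrix (Fin 3) (Fin 3) ℝ) (u v w : Fin 3 → ℝ) :
    triple (M *ᵥ u) (M *ᵥ v) (M *ᵥ w) = M.det * triple u v w := by
  simp [triple, cross_apply, det_fin_three, mulVec, dotProduct, Fin.sum_univ_three]
  ring

theorem triple_smul (a b c : ℝ) (u v w : Fin 3 → ℝ) :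
    triple (a • u) (b • v) (c • w) = a * b * c * triple u v w := by
  simp [triple, cross_apply, dotProduct, Fin.sum_univ_three]
  ring

theorem triple_cross (u v w x y : Fin 3 → ℝ) :
    triple (crossProduct u v) (crossProduct v w) (crossProduct x y) =
      triple u v w * triple v x y := by
  simp [triple, cross_apply, dotProduct, Fin.sum_univ_three]
  ring

theorem triple_perm (u v w : Fin 3 → ℝ) : triple u v w = triple v w u :=
  triple_product_permutation u v w

/-! ### Positive octagons -/

/-- A projectively invariant form of convexity: the vertices have homogeneous coordinates for
which every vertex lies on the positive side of every edge. -/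
def IsPositive (P : Octagon) : Prop :=
  ∃ v : ZMod 8 → Fin 3 → ℝ, (∀ i, IsRep (P i) (v i)) ∧
    ∀ i j, j ≠ i → j ≠ i + 1 → 0 < triple (v i) (v (i + 1)) (v j)

theorem IsPositive.gl_smul {P : Octagon} (h : IsPositive P) (g : GL (Fin 3) ℝ) :
    IsPositive (fun i => g • P i) := by
  obtain ⟨v, hv, h⟩ := h
  have hg : (g : Matrix (Fin 3) (Fin 3) ℝ).det ≠ 0 := GeneralLinearGroup.det_ne_zero g
  -- Rescaling each vector by `det g` multiplies every triple product by `det³ · det = det⁴ > 0`, so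
  -- orientation-reversing `g` need no separate case.
  refine ⟨fun i => (g : Matrix (Fin 3) (Fin 3) ℝ).det • ((g : Matrix (Fin 3) (Fin 3) ℝ) *ᵥ v i),
    fun i => ((hv i).gl_smul g).smul hg, fun i j hi hj => ?_⟩
  rw [triple_smul, triple_mulVec]
  have := h i j hi hj
  have : 0 < (g : Matrix (Fin 3) (Fin 3) ℝ).det ^ 2 := by positivity
  have : 0 < ((g : Matrix (Fin 3) (Fin 3) ℝ).det ^ 2) ^ 2 := by positivity
  calc 0 < ((g : Matrix (Fin 3) (Fin 3) ℝ).det ^ 2) ^ 2 * triple (v i) (v (i + 1)) (v j) := by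
        positivity
    _ = _ := by ring

theorem IsConvex.isPositive {P : Octagon} (h : IsConvex P) : IsPositive P := by
  obtain ⟨g, x, y, hg, h⟩ := h
  have : IsPositive (fun i => affinePoint (x i) (y i)) := by
    refine ⟨fun i => ![x i, y i, 1], fun i => isRep_affinePoint _ _, fun i j hi hj => ?_⟩
    have := h i j hi hj
    simp [triple, cross_apply, dotProduct, Fin.sum_univ_three]
    linarith
  convert this.gl_smul g⁻¹ using 2 with i
  rw [← hg, inv_smul_smul]

theorem IsPositive.ne_of_ne {P : Octagon} (h : IsPositive P) {i j : ZMod 8} (hij : j ≠ i) :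
    P i ≠ P j := by
  obtain ⟨v, hv, h⟩ := h
  rw [(hv i).ne_iff (hv j)]
  intro h0
  by_cases hj : j = i + 1
  · have := h i (i + 2) (by simp; decide) (by simp; decide)
    rw [triple_perm, triple_perm, ← hj, triple, h0] at this
    simp at this
  · have := h i j hij hj
    rw [triple_perm, triple, ← cross_anticomm, h0] at this
    simp at this

/-- The dual octagon, whose vertices are the edges of the given one. -/
def dual (P : Octagon) : Octagon := fun i => edgeLine P i

/-- By `triple_cross`, a triple product of edges `i`, `i + 1`, `j` factors into two triple products
of vertices, each positive by convexity. -/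
theorem IsPositive.dual {P : Octagon} (h : IsPositive P) : IsPositive (dual P) := by
  have hne : ∀ i : ZMod 8, P (i - 1) ≠ P i := fun i => h.ne_of_ne (by revert i; decide)
  obtain ⟨v, hv, h⟩ := h
  refine ⟨fun i => crossProduct (v (i - 1)) (v i), fun i => (hv _).join (hv _)
    (((hv _).ne_iff (hv _)).1 (hne i)), fun i j hi hj => ?_⟩
  simp only [add_sub_cancel_right, triple_cross]
  have h1 := h (i - 1) (i + 1) (by simp [sub_eq_add_neg]; decide) (by simp; decide)
  rw [sub_add_cancel] at h1
  have h2 := h (j - 1) i (by rintro rfl; simp at hj) (by simpa using hi.symm)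
  rw [sub_add_cancel, ← triple_perm] at h2
  exact mul_pos h1 h2

theorem IsPositive.sub_one_ne {P : Octagon} (h : IsPositive P) (i : ZMod 8) :
    P (i - 1) ≠ P i :=
  h.ne_of_ne (by revert i; decide)

theorem dual_smul (g : GL (Fin 3) ℝ) {P : Octagon} (h : ∀ i, P (i - 1) ≠ P i) :
    dual (fun i => g • P i) = fun i => contragredient g • dual P i :=
  funext fun i => join_smul g (h i)

theorem dual_dual {P : Octagon} (h : ∀ i, P (i - 1) ≠ P i)
    (h' : ∀ i, dual P (i - 1) ≠ dual P i) (i : ZMod 8) : dual (dual P) i = P (i - 1) := by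
  have := h' i
  simp only [dual, edgeLine] at *
  exact join_join_eq (h _) (h _) this

/-! ### Octagons with a projective 4-fold symmetry -/

theorem forall_zmod8 {p : ZMod 8 → Prop} (h0 : p 0) (h1 : p 1) (h2 : p 2) (h3 : p 3) (h4 : p 4)
    (h5 : p 5) (h6 : p 6) (h7 : p 7) (i : ZMod 8) : p i := by
  fin_cases i <;> assumption

/-- The first coordinates of the orbit of the pair of points `(m, n)`, `(m', n')` under the
quarter turns about the origin. -/
def coordX (m n m' n' : ℝ) (i : ZMod 8) : ℝ :=
  (![m, m', -n, -n', -m, -m', n, n'] : Fin 8 → ℝ) i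

/-- The second coordinates of the orbit of the pair of points `(m, n)`, `(m', n')` under the
quarter turns about the origin. -/
def coordY (m n m' n' : ℝ) (i : ZMod 8) : ℝ :=
  (![n, n', m, m', -n, -n', -m, -m'] : Fin 8 → ℝ) i

theorem coordX_eq (m n m' n' : ℝ) :
    coordX m n m' n' 0 = m ∧ coordX m n m' n' 1 = m' ∧ coordX m n m' n' 2 = -n ∧
    coordX m n m' n' 3 = -n' ∧ coordX m n m' n' 4 = -m ∧ coordX m n m' n' 5 = -m' ∧
    coordX m n m' n' 6 = n ∧ coordX m n m' n' 7 = n' :=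
  ⟨rfl, rfl, rfl, rfl, rfl, rfl, rfl, rfl⟩

theorem coordY_eq (m n m' n' : ℝ) :
    coordY m n m' n' 0 = n ∧ coordY m n m' n' 1 = n' ∧ coordY m n m' n' 2 = m ∧
    coordY m n m' n' 3 = m' ∧ coordY m n m' n' 4 = -n ∧ coordY m n m' n' 5 = -n' ∧
    coordY m n m' n' 6 = -m ∧ coordY m n m' n' 7 = -m' :=
  ⟨rfl, rfl, rfl, rfl, rfl, rfl, rfl, rfl⟩

/-- The octagon swept out by two points under the quarter turns about the origin. -/
def rotOctagon (m n m' n' : ℝ) : Octagon :=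
  fun i => affinePoint (coordX m n m' n' i) (coordY m n m' n' i)

/-- The octagon `1, z, i, iz, -1, ...` with `z = x.1 + i x.2`. -/
def stdOctagon (x : ℝ × ℝ) : Octagon := rotOctagon 1 0 x.1 x.2

/-- `P` is projectively equivalent to the octagon `1, z, i, iz, -1, ...`. -/
def HasParam (P : Octagon) (x : ℝ × ℝ) : Prop :=
  ∃ g : GL (Fin 3) ℝ, ∀ i, P i = g • stdOctagon x i

theorem smul_affinePoint {g : GL (Fin 3) ℝ} {x y x' y' : ℝ}
    (h : (g : Matrix (Fin 3) (Fin 3) ℝ) *ᵥ ![x, y, 1] = ![x', y', 1]) :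
    g • affinePoint x y = affinePoint x' y' :=
  ((isRep_affinePoint x y).gl_smul g).eq (isRep_affinePoint x' y') 1 (by rw [h, one_smul])

/-- The similarity `(x, y) ↦ (m x - ε n y + c, n x + ε m y + c')`. -/
def similarity (c c' m n ε : ℝ) (h : m ^ 2 + n ^ 2 ≠ 0) (hε : ε = 1 ∨ ε = -1) : GL (Fin 3) ℝ :=
  GeneralLinearGroup.mkOfDetNeZero !![m, -ε * n, c; n, ε * m, c'; 0, 0, 1] (by
    have : det !![m, -ε * n, c; n, ε * m, c'; 0, 0, 1] = ε * (m ^ 2 + n ^ 2) := by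
      rw [det_fin_three]; simp; ring
    rw [this]
    exact mul_ne_zero (by rcases hε with rfl | rfl <;> norm_num) h)

theorem similarity_smul (c c' m n ε : ℝ) (h : m ^ 2 + n ^ 2 ≠ 0) (hε : ε = 1 ∨ ε = -1)
    (x y : ℝ) : similarity c c' m n ε h hε • affinePoint x y =
      affinePoint (m * x - ε * n * y + c) (n * x + ε * m * y + c') := by
  apply smul_affinePoint
  ext i
  fin_cases i <;> simp [similarity, GeneralLinearGroup.mkOfDetNeZero, mulVec, dotProduct,
    Fin.sum_univ_three]
  ring

/-- The hypotheses say `m' + i n' = (m + i n) z`: the parameter is the complex ratio of vertex 1 to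
vertex 0. -/
theorem rotOctagon_hasParam {m n m' n' : ℝ} (h : m ^ 2 + n ^ 2 ≠ 0) {x : ℝ × ℝ}
    (hm : m' = m * x.1 - n * x.2) (hn : n' = n * x.1 + m * x.2) :
    HasParam (rotOctagon m n m' n') x := by
  refine ⟨similarity 0 0 m n 1 h (Or.inl rfl), fun i => ?_⟩
  subst hm hn
  rw [stdOctagon, rotOctagon, rotOctagon, similarity_smul, affinePoint_inj]
  revert i
  refine forall_zmod8 ?_ ?_ ?_ ?_ ?_ ?_ ?_ ?_ <;>
  · simp only [coordX_eq, coordY_eq]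
    constructor <;> ring

theorem HasParam.gl_smul {P : Octagon} {x : ℝ × ℝ} (h : HasParam P x) (g : GL (Fin 3) ℝ) :
    HasParam (fun i => g • P i) x := by
  obtain ⟨g', h⟩ := h
  exact ⟨g * g', fun i => by simp only [h, mul_smul]⟩

theorem HasParam.add_four {P : Octagon} {x : ℝ × ℝ} (h : HasParam P x) :
    HasParam (fun i => P (i + 4)) x := by
  obtain ⟨g, h⟩ := h
  have hs : (-1 : ℝ) ^ 2 + 0 ^ 2 ≠ 0 := by norm_num
  refine ⟨g * similarity 0 0 (-1) 0 1 hs (Or.inl rfl), fun i => ?_⟩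
  simp only [h]
  rw [mul_smul]
  congr 1
  rw [stdOctagon, rotOctagon, rotOctagon, similarity_smul]
  rw [affinePoint_inj]
  revert i
  refine forall_zmod8 ?_ ?_ ?_ ?_ ?_ ?_ ?_ ?_ <;>
  · reduce_mod_char
    simp [coordX_eq, coordY_eq]

theorem IsConvex.gl_smul {P : Octagon} (h : IsConvex P) (g : GL (Fin 3) ℝ) :
    IsConvex (fun i => g • P i) := by
  obtain ⟨g', x, y, hg, h⟩ := h
  exact ⟨g' * g⁻¹, x, y, fun i => by rw [mul_smul, inv_smul_smul, hg], h⟩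

theorem IsConvex.shift {P : Octagon} (h : IsConvex P) (k : ZMod 8) :
    IsConvex (fun i => P (i + k)) := by
  obtain ⟨g, x, y, hg, h⟩ := h
  refine ⟨g, fun i => x (i + k), fun i => y (i + k), fun i => hg _, fun i j hi hj => ?_⟩
  have := h (i + k) (j + k) (by simpa using hi)
    (by rw [add_right_comm]; simpa using hj)
  simpa only [add_right_comm i 1 k] using this

theorem ConvexParam.stdOctagon_isConvex {x : ℝ × ℝ} (h : ConvexParam x) :
    IsConvex (stdOctagon x) := by
  refine ⟨1, _, _, fun i => one_smul _ _, ?_⟩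
  obtain ⟨ha, hb⟩ := h.pos
  obtain ⟨hlt, hgt⟩ := abs_lt.1 h.abs_lt_one
  obtain ⟨h1, h2⟩ := h
  obtain ⟨a, b⟩ := x
  simp only at *
  -- `h3` places vertex 3 to the left of edge 0–1, and `h4` places vertex 7 to the left of edge 1–2.
  have h3 : 0 < b + (a ^ 2 + b ^ 2) - a := by nlinarith [sq_nonneg (a - b - 1)]
  have h4 : 0 < a + (a ^ 2 + b ^ 2) - b := by nlinarith [sq_nonneg (a - b + 1)]
  refine forall_zmod8 ?_ ?_ ?_ ?_ ?_ ?_ ?_ ?_ <;>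
  refine forall_zmod8 ?_ ?_ ?_ ?_ ?_ ?_ ?_ ?_ <;>
  · reduce_mod_char
    intro hi hj
    first
    | exact absurd rfl hi
    | exact absurd rfl hj
    | simp only [coordX_eq, coordY_eq]
      linarith

theorem HasParam.isConvex {P : Octagon} {x : ℝ × ℝ} (h : HasParam P x) (hx : ConvexParam x) :
    IsConvex P := by
  obtain ⟨g, h⟩ := h
  rw [funext h]
  exact hx.stdOctagon_isConvex.gl_smul g

/-- Positivity allows a different scalar `c i` at each vertex. Central symmetry forces all of them
to have one sign, after which a few determinants give the inequalities. -/
theorem IsPositive.convexParam_of_std {x : ℝ × ℝ} (h : IsPositive (stdOctagon x)) :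
    ConvexParam x := by
  obtain ⟨v, hv, h⟩ := h
  have hex : ∀ i, ∃ c : ℝ, c ≠ 0 ∧
      v i = c • ![coordX 1 0 x.1 x.2 i, coordY 1 0 x.1 x.2 i, 1] := fun i =>
    (hv i).exists_smul (isRep_affinePoint _ _)
  choose c hc0 hc using hex
  obtain ⟨a, b⟩ := x
  have key : ∀ i j, j ≠ i → j ≠ i + 1 → 0 < c i * c (i + 1) * c j *
      triple ![coordX 1 0 a b i, coordY 1 0 a b i, 1]
        ![coordX 1 0 a b (i + 1), coordY 1 0 a b (i + 1), 1]
        ![coordX 1 0 a b j, coordY 1 0 a b j, 1] := by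
    intro i j hi hj
    have := h i j hi hj
    rwa [hc i, hc (i + 1), hc j, triple_smul] at this
  -- Opposite edges are parallel, so vertices `i + 4` and `i + 5` have the same determinant against
  -- edge `i`, and their scalars must agree in sign.
  have hopp : ∀ i, 0 < c (i + 4) * c (i + 5) := by
    intro i
    have h1 := key i (i + 4) (by simp; decide) (by simp; decide)
    have h2 := key i (i + 5) (by simp; decide) (by simp; decide)
    have h3 := mul_pos h1 h2
    have h4 : triple ![coordX 1 0 a b i, coordY 1 0 a b i, 1]
        ![coordX 1 0 a b (i + 1), coordY 1 0 a b (i + 1), 1]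
        ![coordX 1 0 a b (i + 4), coordY 1 0 a b (i + 4), 1] =
        triple ![coordX 1 0 a b i, coordY 1 0 a b i, 1]
        ![coordX 1 0 a b (i + 1), coordY 1 0 a b (i + 1), 1]
        ![coordX 1 0 a b (i + 5), coordY 1 0 a b (i + 5), 1] := by
      revert i
      refine forall_zmod8 ?_ ?_ ?_ ?_ ?_ ?_ ?_ ?_ <;>
      · reduce_mod_char
        intros
        simp [coordX_eq, coordY_eq, triple, cross_apply, dotProduct, Fin.sum_univ_three]
        try ring
    rw [h4] at h3
    set t := triple ![coordX 1 0 a b i, coordY 1 0 a b i, 1]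
        ![coordX 1 0 a b (i + 1), coordY 1 0 a b (i + 1), 1]
        ![coordX 1 0 a b (i + 5), coordY 1 0 a b (i + 5), 1]
    have h5 : c i * c (i + 1) * c (i + 4) * t * (c i * c (i + 1) * c (i + 5) * t) =
      (c i * c (i + 1) * t) ^ 2 * (c (i + 4) * c (i + 5)) := by ring
    rw [h5] at h3
    exact pos_of_mul_pos_right h3 (sq_nonneg _)
  have hstep : ∀ i, 0 < c i * c (i + 1) := by
    intro i
    have := hopp (i - 4)
    rwa [sub_add_cancel, show i - 4 + 5 = i + 1 by ring] at this
  have hsame : ∀ i, 0 < c 0 * c i := by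
    have hn : ∀ n : ℕ, 0 < c 0 * c n := by
      intro n
      induction n with
      | zero => simpa using mul_self_pos.2 (hc0 0)
      | succ n ih =>
        have h1 := mul_pos ih (hstep n)
        have h2 : c 0 * c n * (c n * c (n + 1)) = c n ^ 2 * (c 0 * c (n + 1)) := by ring
        rw [h2] at h1
        push_cast
        exact pos_of_mul_pos_right h1 (sq_nonneg _)
    intro i
    simpa using hn i.val
  have key2 : ∀ i j, j ≠ i → j ≠ i + 1 → 0 < c 0 *
      triple ![coordX 1 0 a b i, coordY 1 0 a b i, 1]
        ![coordX 1 0 a b (i + 1), coordY 1 0 a b (i + 1), 1]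
        ![coordX 1 0 a b j, coordY 1 0 a b j, 1] := by
    intro i j hi hj
    have h1 := mul_pos (key i j hi hj) (mul_pos (hsame i) (mul_pos (hsame (i + 1)) (hsame j)))
    set t := triple ![coordX 1 0 a b i, coordY 1 0 a b i, 1]
        ![coordX 1 0 a b (i + 1), coordY 1 0 a b (i + 1), 1]
        ![coordX 1 0 a b j, coordY 1 0 a b j, 1]
    have h2 : c i * c (i + 1) * c j * t * (c 0 * c i * (c 0 * c (i + 1) * (c 0 * c j))) =
      (c 0 * c i * c (i + 1) * c j) ^ 2 * (c 0 * t) := by ring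
    rw [h2] at h1
    exact pos_of_mul_pos_right h1 (sq_nonneg _)
  have k2 := key2 0 2 (by decide) (by decide)
  have k6 := key2 0 6 (by decide) (by decide)
  have k7 := key2 0 7 (by decide) (by decide)
  have l4 := key2 1 4 (by decide) (by decide)
  reduce_mod_char at k2 k6 k7 l4
  simp [coordX_eq, coordY_eq, triple, cross_apply, dotProduct, Fin.sum_univ_three] at k2 k6 k7 l4
  -- `k6` and `l4` bound `c 0 * (1 - a + b)` and `c 0 * (1 + a - b)` below by zero; their sum is `2
  -- * c 0`.
  have hpos : 0 < c 0 := by nlinarith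
  have k2' := pos_of_mul_pos_right k2 hpos.le
  have k7' := pos_of_mul_pos_right k7 hpos.le
  constructor <;> simp only <;> nlinarith

theorem HasParam.convexParam {P : Octagon} {x : ℝ × ℝ} (h : HasParam P x) (hP : IsPositive P) :
    ConvexParam x := by
  obtain ⟨g, h⟩ := h
  apply IsPositive.convexParam_of_std
  convert hP.gl_smul g⁻¹ using 2 with i
  rw [h, inv_smul_smul]

/-! ### The 3-diagonal map on octagons with a 4-fold symmetry -/

theorem mem_T3 {P Q : Octagon} : Q ∈ T3 P ↔
    (∀ i, P i ≠ P (i + 3) ∧ diagonal P i ≠ diagonal P (i + 1)) ∧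
      Q = fun i => join (diagonal P i) (diagonal P (i + 1)) :=
  ⟨fun ⟨h, e⟩ => ⟨h, e.symm⟩, fun ⟨h, e⟩ => ⟨h, e.symm⟩⟩

theorem mem_T3Inv {P Q : Octagon} : Q ∈ T3Inv P ↔
    (∀ i, P (i - 1) ≠ P i ∧ edgeLine P i ≠ edgeLine P (i - 3)) ∧
      Q = fun i => join (edgeLine P i) (edgeLine P (i - 3)) :=
  ⟨fun ⟨h, e⟩ => ⟨h, e.symm⟩, fun ⟨h, e⟩ => ⟨h, e.symm⟩⟩

theorem T3_smul {P Q : Octagon} (h : Q ∈ T3 P) (g : GL (Fin 3) ℝ) :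
    (fun i => g • Q i) ∈ T3 (fun i => g • P i) := by
  obtain ⟨hd, rfl⟩ := mem_T3.1 h
  have hdiag : ∀ i, diagonal (fun i => g • P i) i = contragredient g • diagonal P i :=
    fun i => join_smul g (hd i).1
  refine mem_T3.2 ⟨fun i => ⟨by simpa using (hd i).1, ?_⟩, funext fun i => ?_⟩
  · rw [hdiag, hdiag]
    simpa using (hd i).2
  · exact (join_join_smul g (hd i).1 (hd (i + 1)).1 (hd i).2).symm

/-- The third homogeneous coordinates of the 3-diagonals. -/
def alternating (s t : ℝ) (i : ZMod 8) : ℝ :=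
  (![s, t, s, t, s, t, s, t] : Fin 8 → ℝ) i

theorem alternating_eq (s t : ℝ) :
    alternating s t 0 = s ∧ alternating s t 1 = t ∧ alternating s t 2 = s ∧
    alternating s t 3 = t ∧ alternating s t 4 = s ∧ alternating s t 5 = t ∧
    alternating s t 6 = s ∧ alternating s t 7 = t :=
  ⟨rfl, rfl, rfl, rfl, rfl, rfl, rfl, rfl⟩

theorem crossProduct_vec (a b c a' b' c' : ℝ) :
    crossProduct ![a, b, c] ![a', b', c'] =
      ![b * c' - c * b', c * a' - a * c', a * b' - b * a'] := by
  simp [cross_apply]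

theorem isRep_diagonal_std {x : ℝ × ℝ} (h : ConvexParam x) (i : ZMod 8) :
    stdOctagon x i ≠ stdOctagon x (i + 3) ∧ IsRep (diagonal (stdOctagon x) i)
      ![coordX (-x.1) (-x.2 - 1) x.2 (-1 - x.1) i, coordY (-x.1) (-x.2 - 1) x.2 (-1 - x.1) i,
        alternating x.1 x.2 i] := by
  obtain ⟨ha, hb⟩ := h.pos
  obtain ⟨a, b⟩ := x
  have hc : crossProduct ![coordX 1 0 a b i, coordY 1 0 a b i, 1]
      ![coordX 1 0 a b (i + 3), coordY 1 0 a b (i + 3), 1] =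
      ![coordX (-a) (-b - 1) b (-1 - a) i, coordY (-a) (-b - 1) b (-1 - a) i,
        alternating a b i] := by
    revert i
    refine forall_zmod8 ?_ ?_ ?_ ?_ ?_ ?_ ?_ ?_ <;>
    · reduce_mod_char
      simp only [coordX_eq, coordY_eq, alternating_eq, crossProduct_vec]
      congrm ![?_, ?_, ?_] <;> ring
  have hne : crossProduct ![coordX 1 0 a b i, coordY 1 0 a b i, 1]
      ![coordX 1 0 a b (i + 3), coordY 1 0 a b (i + 3), 1] ≠ 0 := by
    rw [hc]
    intro h0
    have h2 : alternating a b i = 0 := congrFun h0 2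
    clear hc h0
    revert i
    refine forall_zmod8 ?_ ?_ ?_ ?_ ?_ ?_ ?_ ?_ <;>
    · simp only [alternating_eq]
      intro h2
      simp_all
  have hr := fun i => isRep_affinePoint (coordX 1 0 a b i) (coordY 1 0 a b i)
  refine ⟨((hr i).ne_iff (hr _)).2 hne, ?_⟩
  have := (hr i).join (hr (i + 3)) hne
  rwa [hc] at this

/-- Here `(m, n)` and `(m', n')` are vertices 0 and 1 of the image, with denominators cleared. These
denominators are the third coordinates of the cross products of successive diagonals. -/
theorem T3_stdOctagon {x : ℝ × ℝ} (h : ConvexParam x) {m n m' n' : ℝ}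
    (hm : (x.1 ^ 2 + x.2 ^ 2 + x.1 + x.2) * m = (x.1 - x.2) * (x.1 + x.2 + 1))
    (hn : (x.1 ^ 2 + x.2 ^ 2 + x.1 + x.2) * n = 2 * x.1 * x.2)
    (hm' : (1 + x.1 + x.2) * m' = -x.1 * (1 + x.1 - x.2))
    (hn' : (1 + x.1 + x.2) * n' = x.2 * (1 - x.1 + x.2)) :
    rotOctagon m n m' n' ∈ T3 (stdOctagon x) := by
  obtain ⟨ha, hb⟩ := h.pos
  have hd := isRep_diagonal_std h
  obtain ⟨a, b⟩ := x
  simp only at *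
  have hc : ∀ i, crossProduct
      ![coordX (-a) (-b - 1) b (-1 - a) i, coordY (-a) (-b - 1) b (-1 - a) i, alternating a b i]
      ![coordX (-a) (-b - 1) b (-1 - a) (i + 1), coordY (-a) (-b - 1) b (-1 - a) (i + 1),
        alternating a b (i + 1)] =
      alternating (a ^ 2 + b ^ 2 + a + b) (1 + a + b) i •
        ![coordX m n m' n' i, coordY m n m' n' i, 1] := by
    refine forall_zmod8 ?_ ?_ ?_ ?_ ?_ ?_ ?_ ?_ <;>
    · reduce_mod_char
      simp only [coordX_eq, coordY_eq, alternating_eq, crossProduct_vec, smul_cons, smul_eq_mul,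
        smul_empty]
      congrm ![?_, ?_, ?_] <;> linarith
  have hs : ∀ i, alternating (a ^ 2 + b ^ 2 + a + b) (1 + a + b) i ≠ 0 := by
    refine forall_zmod8 ?_ ?_ ?_ ?_ ?_ ?_ ?_ ?_ <;>
    · simp only [alternating_eq]
      positivity
  have hne : ∀ i, crossProduct
      ![coordX (-a) (-b - 1) b (-1 - a) i, coordY (-a) (-b - 1) b (-1 - a) i, alternating a b i]
      ![coordX (-a) (-b - 1) b (-1 - a) (i + 1), coordY (-a) (-b - 1) b (-1 - a) (i + 1),
        alternating a b (i + 1)] ≠ 0 := by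
    intro i
    rw [hc]
    refine smul_ne_zero (hs i) fun h0 => ?_
    have := congrFun h0 2
    simp at this
  refine mem_T3.2 ⟨fun i => ⟨(hd i).1, ((hd i).2.ne_iff (hd _).2).2 (hne i)⟩, funext fun i => ?_⟩
  exact ((isRep_affinePoint _ _).smul (hs i)).eq ((hd i).2.join (hd _).2 (hne i)) 1
    (by rw [one_smul, hc])

theorem HasParam.exists_mem_T3 {P : Octagon} {x : ℝ × ℝ} (h : HasParam P x)
    (hx : ConvexParam x) : ∃ Q ∈ T3 P, HasParam Q (nextParam x) := by
  obtain ⟨g, h⟩ := h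
  obtain ⟨ha, hb⟩ := hx.pos
  have hD : x.1 ^ 2 + x.2 ^ 2 + x.1 + x.2 ≠ 0 := by positivity
  have hE : 1 + x.1 + x.2 ≠ 0 := by positivity
  have hQ := T3_stdOctagon hx (mul_div_cancel₀ _ hD) (mul_div_cancel₀ _ hD)
    (mul_div_cancel₀ _ hE) (mul_div_cancel₀ _ hE)
  refine ⟨_, by rw [funext h]; exact T3_smul hQ g,
    HasParam.gl_smul (rotOctagon_hasParam ?_ ?_ ?_) g⟩
  · positivity
  all_goals
    have hM := growth_denom_pos (d := x.1 - x.2) hx.1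
    simp only [nextParam, nextSum, nextDiff]
    obtain ⟨a, b⟩ := x
    simp only at *
    have hE' : 1 + (a + b) ≠ 0 := by positivity
    have hM' := hM.ne'
    rw [show 1 + a + b = 1 + (a + b) by ring]
    -- `M` is `4 (a² + b² + a + b)² (m² + n²)`, with `(m, n)` vertex 0 of the image: the denominator
    -- arising from division by `m + i n`.
    generalize hMd : 4 * (a - b) ^ 2 * (a + b + 1) ^ 2 + ((a + b) ^ 2 - (a - b) ^ 2) ^ 2 = M at *
    field_simp
    rw [← hMd]
    ring

/-- Quarter turns about the origin act on line coordinates as on points, so the edge lines again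
form a rotational octagon. Clearing denominators in `y.1 = y.2` leaves `|z| = 1`. -/
theorem HasParam.dual {P : Octagon} {x : ℝ × ℝ} (h : HasParam P x) (hP : IsPositive P) :
    ∃ y, HasParam (dual P) y ∧ (y.1 = y.2 ↔ x.1 ^ 2 + x.2 ^ 2 = 1) := by
  have hx := h.convexParam hP
  obtain ⟨g, h⟩ := h
  have hstd : IsPositive (stdOctagon x) := hx.stdOctagon_isConvex.isPositive
  obtain ⟨ha, hb⟩ := hx.pos
  obtain ⟨a, b⟩ := x
  simp only at *
  have hdual : ∀ i, Pentagram.dual (stdOctagon (a, b)) i =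
      rotOctagon (-1) ((1 - b) / a) (-1) (-(1 - a) / b) i := by
    intro i
    have hne := hstd.sub_one_ne i
    have hr := fun i => isRep_affinePoint (coordX 1 0 a b i) (coordY 1 0 a b i)
    refine ((hr (i - 1)).join (hr i) (((hr _).ne_iff (hr _)).1 hne)).eq (isRep_affinePoint _ _)
      (alternating a b i) ?_
    clear hne
    revert i
    refine forall_zmod8 ?_ ?_ ?_ ?_ ?_ ?_ ?_ ?_ <;>
    · reduce_mod_char
      simp only [coordX_eq, coordY_eq, alternating_eq, crossProduct_vec, smul_cons, smul_eq_mul,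
        smul_empty]
      congrm ![?_, ?_, ?_] <;> field_simp <;> ring
  have hd : (-1) ^ 2 + ((1 - b) / a) ^ 2 ≠ 0 := by positivity
  refine ⟨((1 - (1 - b) * (1 - a) / (a * b)) / (1 + ((1 - b) / a) ^ 2),
    ((1 - a) / b + (1 - b) / a) / (1 + ((1 - b) / a) ^ 2)), ?_, ?_⟩
  · have h1 : (fun i => contragredient g • Pentagram.dual (stdOctagon (a, b)) i) =
        Pentagram.dual P := by
      rw [funext h, dual_smul g hstd.sub_one_ne]
    rw [← h1, funext hdual]
    refine HasParam.gl_smul (rotOctagon_hasParam hd ?_ ?_) _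
    all_goals
      have : 1 + ((1 - b) / a) ^ 2 ≠ 0 := by positivity
      simp only
      field_simp
      ring
  · have : 1 + ((1 - b) / a) ^ 2 ≠ 0 := by positivity
    simp only
    rw [div_left_inj' this]
    field_simp
    constructor <;> intro h <;> linarith

/-- The vertices of `T3Inv Q` are the 3-diagonals of `dual Q`, so its dual is `T3 (dual Q)` with
labels shifted by 4. The half turn absorbs this shift. -/
theorem exists_mem_T3Inv {Q : Octagon} {y : ℝ × ℝ} (hQ : IsPositive Q)
    (h : HasParam (dual Q) y) : ∃ W ∈ T3Inv Q, HasParam (dual W) (nextParam y) ∧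
      ∀ i, W (i - 1) ≠ W i := by
  obtain ⟨R, hR, hRy⟩ := h.exists_mem_T3 (h.convexParam hQ.dual)
  obtain ⟨hd, rfl⟩ := mem_T3.1 hR
  have hW : ∀ i, join (edgeLine Q i) (edgeLine Q (i - 3)) = diagonal (dual Q) (i - 3) := by
    intro i
    rw [diagonal, sub_add_cancel, join_comm]
    rfl
  refine ⟨fun i => join (edgeLine Q i) (edgeLine Q (i - 3)), mem_T3Inv.2 ⟨fun i =>
    ⟨hQ.sub_one_ne i, ?_⟩, rfl⟩, ?_, fun i => ?_⟩
  · have := (hd (i - 3)).1.symm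
    rwa [sub_add_cancel] at this
  · convert hRy.add_four using 2 with i
    change join (join (edgeLine Q (i - 1)) (edgeLine Q (i - 1 - 3)))
      (join (edgeLine Q i) (edgeLine Q (i - 3))) = _
    rw [hW, hW]
    congr 2
    · revert i; decide
    · revert i; decide
  · have := (hd (i - 4)).2
    rw [show i - 4 + 1 = i - 3 by ring, show i - 4 = i - 1 - 3 by ring, ← hW, ← hW] at this
    exact this

/-! ### Convexity along orbits -/

theorem orbit_natCast (P : Octagon) (n : ℕ) :
    orbit P n = (fun Q => Q.bind T3)^[n] (Part.some P) := rfl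

theorem orbit_neg_natCast (P : Octagon) (n : ℕ) :
    orbit P (-(n : ℤ)) = (fun Q => Q.bind T3Inv)^[n] (Part.some P) := by
  cases n <;> rfl

theorem orbitConvexAt_zero {P : Octagon} : OrbitConvexAt P 0 ↔ IsConvex P := by
  change (∃ Q ∈ Part.some P, IsConvex Q) ↔ _
  simp

theorem OrbitConvexAt.isConvex {P Q : Octagon} {j : ℤ} (h : OrbitConvexAt P j)
    (hQ : Q ∈ orbit P j) : IsConvex Q := by
  obtain ⟨R, hR, h⟩ := h
  rwa [Part.mem_unique hQ hR]

/-- Convexity strictly before time `n` already makes `P_n` defined, with known parameter. Convexity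
at time `n` can then be tested on that parameter, which is what the strong induction below requires.
-/
theorem HasParam.exists_mem_orbit {P : Octagon} {x : ℝ × ℝ} (h : HasParam P x) (n : ℕ)
    (hx : ∀ m < n, ConvexParam (nextParam^[m] x)) :
    ∃ Q ∈ orbit P n, HasParam Q (nextParam^[n] x) := by
  induction n with
  | zero => exact ⟨P, Part.mem_some _, h⟩
  | succ n ih =>
    obtain ⟨Q, hQ, hQx⟩ := ih fun m hm => hx m (hm.trans n.lt_succ_self)
    obtain ⟨R, hR, hRx⟩ := hQx.exists_mem_T3 (hx n n.lt_succ_self)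
    refine ⟨R, ?_, by rwa [Function.iterate_succ_apply']⟩
    rw [orbit_natCast, Function.iterate_succ_apply', ← orbit_natCast]
    exact Part.mem_bind hQ hR

/-- The forward orbit stays convex only on the symmetry line `x.1 = x.2`. -/
theorem HasParam.forall_nonneg_convexAt_iff {P : Octagon} {x : ℝ × ℝ} (h : HasParam P x)
    (hP : IsPositive P) : (∀ j : ℤ, 0 ≤ j → OrbitConvexAt P j) ↔ x.1 = x.2 := by
  constructor
  · intro hj
    refine eq_of_forall_convexParam fun n => ?_
    induction n using Nat.strong_induction_on with
    | _ n ih =>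
      obtain ⟨Q, hQ, hQx⟩ := h.exists_mem_orbit n ih
      exact hQx.convexParam ((hj n (by simp)).isConvex hQ).isPositive
  · intro he j hj
    lift j to ℕ using hj
    have hx := (h.convexParam hP).iterate_of_eq he
    obtain ⟨Q, hQ, hQx⟩ := h.exists_mem_orbit j fun m _ => (hx m).1
    exact ⟨Q, hQ, hQx.isConvex (hx j).1⟩

theorem isConvex_of_dual {W : Octagon} {y : ℝ × ℝ} (h : HasParam (dual W) y)
    (hy : ConvexParam y) (hW : ∀ i, W (i - 1) ≠ W i) : IsConvex W := by
  have h1 := (h.isConvex hy).isPositive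
  obtain ⟨z, hz, -⟩ := h.dual h1
  -- The bidual of `W` is `W` with labels shifted by one, and the shift is undone here.
  have h2 := (hz.isConvex (hz.convexParam h1.dual)).shift 1
  simpa [dual_dual hW h1.sub_one_ne] using h2

theorem exists_mem_orbit_neg {P : Octagon} {y : ℝ × ℝ} (h : HasParam (dual P) y)
    (hP : IsPositive P) (n : ℕ) (hy : ∀ m < n, ConvexParam (nextParam^[m] y)) :
    ∃ Q ∈ orbit P (-(n : ℤ)), HasParam (dual Q) (nextParam^[n] y) ∧
      ∀ i, Q (i - 1) ≠ Q i := by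
  induction n with
  | zero => exact ⟨P, Part.mem_some _, h, hP.sub_one_ne⟩
  | succ n ih =>
    obtain ⟨Q, hQ, hQy, hne⟩ := ih fun m hm => hy m (hm.trans n.lt_succ_self)
    have hpos := (isConvex_of_dual hQy (hy n n.lt_succ_self) hne).isPositive
    obtain ⟨R, hR, hRy, hRne⟩ := exists_mem_T3Inv hpos hQy
    refine ⟨R, ?_, by rwa [Function.iterate_succ_apply'], hRne⟩
    rw [orbit_neg_natCast, Function.iterate_succ_apply', ← orbit_neg_natCast]
    exact Part.mem_bind hQ hR

/-- The backward orbit stays convex only on the unit circle. -/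
theorem HasParam.forall_nonpos_convexAt_iff {P : Octagon} {x : ℝ × ℝ} (h : HasParam P x)
    (hP : IsPositive P) :
    (∀ j : ℤ, j ≤ 0 → OrbitConvexAt P j) ↔ x.1 ^ 2 + x.2 ^ 2 = 1 := by
  obtain ⟨y, hy, hyx⟩ := h.dual hP
  rw [← hyx]
  constructor
  · intro hj
    refine eq_of_forall_convexParam fun n => ?_
    induction n using Nat.strong_induction_on with
    | _ n ih =>
      obtain ⟨Q, hQ, hQy, -⟩ := exists_mem_orbit_neg hy hP n ih
      exact hQy.convexParam ((hj _ (by simp)).isConvex hQ).isPositive.dual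
  · intro he j hj
    obtain ⟨n, rfl⟩ : ∃ n : ℕ, j = -(n : ℤ) := ⟨j.natAbs, by omega⟩
    have hc := (hy.convexParam hP.dual).iterate_of_eq he
    obtain ⟨Q, hQ, hQy, hne⟩ := exists_mem_orbit_neg hy hP n fun m _ => (hc m).1
    exact ⟨Q, hQ, isConvex_of_dual hQy (hc n).1 hne⟩

/-! ### Euclidean symmetries of the octagon -/

/-- `P` is the image of the octagon `1, z, i, iz, -1, ...` under a similarity of the affine
plane. -/
def HasEuclideanParam (P : Octagon) (c c' m n ε : ℝ) (x : ℝ × ℝ) : Prop :=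
  m ^ 2 + n ^ 2 ≠ 0 ∧ (ε = 1 ∨ ε = -1) ∧ ∀ i, P i = affinePoint
    (m * coordX 1 0 x.1 x.2 i - ε * n * coordY 1 0 x.1 x.2 i + c)
    (n * coordX 1 0 x.1 x.2 i + ε * m * coordY 1 0 x.1 x.2 i + c')

theorem HasEuclideanParam.hasParam {P : Octagon} {c c' m n ε : ℝ} {x : ℝ × ℝ}
    (h : HasEuclideanParam P c c' m n ε x) : HasParam P x := by
  obtain ⟨h, hε, hP⟩ := h
  exact ⟨similarity c c' m n ε h hε, fun i => by
    rw [hP, stdOctagon, rotOctagon, similarity_smul]⟩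

theorem quarterTurn_smul (c c' x y : ℝ) :
    quarterTurn c c' • affinePoint x y = affinePoint (-y + c + c') (x + c' - c) := by
  apply smul_affinePoint
  ext i
  fin_cases i <;> simp [quarterTurn, GeneralLinearGroup.mkOfDetNeZero, mulVec, dotProduct,
    Fin.sum_univ_three] <;> ring

theorem reflection_smul (c c' φ x y : ℝ) :
    reflection c c' φ • affinePoint x y = affinePoint
      (c + (Real.cos (2 * φ) * (x - c) + Real.sin (2 * φ) * (y - c')))
      (c' + (Real.sin (2 * φ) * (x - c) - Real.cos (2 * φ) * (y - c'))) := by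
  apply smul_affinePoint
  ext i
  fin_cases i <;> simp [reflection, GeneralLinearGroup.mkOfDetNeZero, mulVec, dotProduct,
    Fin.sum_univ_three] <;> ring

/-- The half turn acts as `-1` on vectors at infinity, so it fixes every point of the line at
infinity. -/
theorem exists_eq_affinePoint {p : RP2} {c c' : ℝ}
    (h : quarterTurn c c' • quarterTurn c c' • p ≠ p) : ∃ x y, p = affinePoint x y := by
  have hp := isRep_rep p
  by_cases h2 : p.rep 2 = 0
  · refine absurd (((hp.gl_smul _).gl_smul _).eq hp (-1) ?_) h
    ext i
    fin_cases i <;> simp [quarterTurn, GeneralLinearGroup.mkOfDetNeZero, mulVec, dotProduct,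
      Fin.sum_univ_three, h2]
  · refine ⟨p.rep 0 / p.rep 2, p.rep 1 / p.rep 2, hp.eq (isRep_affinePoint _ _) (p.rep 2) ?_⟩
    ext i
    fin_cases i <;> simp <;> field_simp

theorem exists_hasEuclideanParam {P : Octagon} (hP : IsPositive P) {c c' : ℝ}
    (h : HasQuarterTurnSymmetry P c c') : ∃ m n ε x, HasEuclideanParam P c c' m n ε x := by
  obtain ⟨ε, hε, hs⟩ : ∃ ε : ℝ, (ε = 1 ∨ ε = -1) ∧
      ∀ i, ∀ x y, P i = affinePoint (x + c) (y + c') →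
        P (i + 2) = affinePoint (-ε * y + c) (ε * x + c') := by
    rcases h with h | h
    · refine ⟨1, Or.inl rfl, fun i x y hi => ?_⟩
      rw [← h, hi, quarterTurn_smul, affinePoint_inj]
      constructor <;> ring
    · refine ⟨-1, Or.inr rfl, fun i x y hi => ?_⟩
      -- If the quarter turn shifts labels by `-2`, its cube, the clockwise turn, shifts them by
      -- `2`.
      have h6 : ∀ i : ZMod 8, i + 2 = i - 2 - 2 - 2 := by decide
      rw [h6, ← h, ← h, ← h, hi, quarterTurn_smul, quarterTurn_smul, quarterTurn_smul,
        affinePoint_inj]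
      constructor <;> ring
  have haff : ∀ i, ∃ x y, P i = affinePoint (x + c) (y + c') := by
    intro i
    have hne : quarterTurn c c' • quarterTurn c c' • P i ≠ P i := by
      rcases h with h | h
      · rw [h, h]
        exact hP.ne_of_ne (by revert i; decide)
      · rw [h, h]
        exact hP.ne_of_ne (by revert i; decide)
    obtain ⟨x, y, hxy⟩ := exists_eq_affinePoint hne
    exact ⟨x - c, y - c', by rw [hxy]; congr 1 <;> ring⟩
  obtain ⟨m, n, h0⟩ := haff 0
  obtain ⟨m', n', h1⟩ := haff 1
  have h2 := hs _ _ _ h0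
  have hmn : m ^ 2 + n ^ 2 ≠ 0 := by
    intro hz
    have hm : m = 0 := by nlinarith [sq_nonneg n, sq_nonneg m]
    have hn : n = 0 := by nlinarith [sq_nonneg n, sq_nonneg m]
    subst hm hn
    refine hP.ne_of_ne (i := 0) (j := 0 + 2) (by decide) ?_
    rw [h0, h2]
    simp
  have h4 := hs _ _ _ h2
  have h6 := hs _ _ _ h4
  have h3 := hs _ _ _ h1
  have h5 := hs _ _ _ h3
  have h7 := hs _ _ _ h5
  reduce_mod_char at h2 h3 h4 h5 h6 h7
  -- The parameter is the ratio `(m' + i n') / (m + i n)`, conjugated when `ε = -1`.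
  refine ⟨m, n, ε, ((m * m' + n * n') / (m ^ 2 + n ^ 2),
    ε * (m * n' - n * m') / (m ^ 2 + n ^ 2)), hmn, hε, ?_⟩
  have hx : m' = m * ((m * m' + n * n') / (m ^ 2 + n ^ 2)) -
      ε * n * (ε * (m * n' - n * m') / (m ^ 2 + n ^ 2)) := by
    rcases hε with rfl | rfl <;> field_simp <;> ring
  have hy : n' = n * ((m * m' + n * n') / (m ^ 2 + n ^ 2)) +
      ε * m * (ε * (m * n' - n * m') / (m ^ 2 + n ^ 2)) := by
    rcases hε with rfl | rfl <;> field_simp <;> ring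
  simp only
  generalize (m * m' + n * n') / (m ^ 2 + n ^ 2) = a at *
  generalize ε * (m * n' - n * m') / (m ^ 2 + n ^ 2) = b at *
  clear h hs haff hmn
  subst hx hy
  refine forall_zmod8 ?_ ?_ ?_ ?_ ?_ ?_ ?_ ?_ <;>
    simp only [coordX_eq, coordY_eq, h0, h1, h2, h3, h4, h5, h6, h7, affinePoint_inj]
  all_goals rcases hε with rfl | rfl <;> constructor <;> ring

theorem reflection_dist {c c' φ x y x' y' u v u' v' : ℝ}
    (h : reflection c c' φ • affinePoint x y = affinePoint x' y')
    (h' : reflection c c' φ • affinePoint u v = affinePoint u' v') :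
    (x' - u') ^ 2 + (y' - v') ^ 2 = (x - u) ^ 2 + (y - v) ^ 2 := by
  rw [reflection_smul, affinePoint_inj] at h h'
  obtain ⟨rfl, rfl⟩ := h
  obtain ⟨rfl, rfl⟩ := h'
  linear_combination ((x - u) ^ 2 + (y - v) ^ 2) * Real.sin_sq_add_cos_sq (2 * φ)

/-- A reflection preserving the octagon preserves the distances in the model octagon. -/
theorem HasEuclideanParam.reflection_dist {P : Octagon} {c c' m n ε : ℝ} {x : ℝ × ℝ}
    (h : HasEuclideanParam P c c' m n ε x) {d d' φ : ℝ} {i i' j j' : ZMod 8}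
    (hi : reflection d d' φ • P i = P i') (hj : reflection d d' φ • P j = P j') :
    (coordX 1 0 x.1 x.2 i' - coordX 1 0 x.1 x.2 j') ^ 2 +
      (coordY 1 0 x.1 x.2 i' - coordY 1 0 x.1 x.2 j') ^ 2 =
    (coordX 1 0 x.1 x.2 i - coordX 1 0 x.1 x.2 j) ^ 2 +
      (coordY 1 0 x.1 x.2 i - coordY 1 0 x.1 x.2 j) ^ 2 := by
  obtain ⟨hmn, hε, h⟩ := h
  rw [h, h] at hi hj
  have := Pentagram.reflection_dist hi hj
  apply mul_left_cancel₀ hmn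
  rcases hε with rfl | rfl <;> linarith

theorem HasEuclideanParam.eq_of_vertexLine {P : Octagon} {c c' m n ε : ℝ} {x : ℝ × ℝ}
    (h : HasEuclideanParam P c c' m n ε x) {d d' φ : ℝ} (hl : IsVertexSymmetryLine P d d' φ) :
    x.1 = x.2 := by
  obtain ⟨j, -, -, hj⟩ := hl
  -- The vertex `j` is fixed and its neighbours are exchanged, so the two edges at `j` have equal
  -- length.
  have := h.reflection_dist (hj 0) (hj 1)
  clear hj
  revert j
  refine forall_zmod8 ?_ ?_ ?_ ?_ ?_ ?_ ?_ ?_ <;>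
  · reduce_mod_char
    simp only [coordX_eq, coordY_eq]
    intro
    linarith

theorem HasEuclideanParam.eq_of_edgeLine {P : Octagon} {c c' m n ε : ℝ} {x : ℝ × ℝ}
    (h : HasEuclideanParam P c c' m n ε x) {d d' φ : ℝ} (hl : IsEdgeSymmetryLine P d d' φ) :
    x.1 ^ 2 + x.2 ^ 2 = 1 := by
  obtain ⟨j, hj⟩ := hl
  -- The long diagonal from `j` to `j + 4` is carried to the one from `j + 1` to `j + 5`; in the
  -- model their lengths are `2` and `2|z|` in some order.
  have := h.reflection_dist (hj 0) (hj 4)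
  clear hj
  revert j
  refine forall_zmod8 ?_ ?_ ?_ ?_ ?_ ?_ ?_ ?_ <;>
  · reduce_mod_char
    simp only [coordX_eq, coordY_eq]
    intro
    linarith

/-! ### Construction of the symmetry lines -/

theorem onAxis_of_reflection_smul {c c' φ x y : ℝ}
    (h : reflection c c' φ • affinePoint x y = affinePoint x y) :
    OnAxis c c' φ (affinePoint x y) := by
  rw [reflection_smul, affinePoint_inj, Real.sin_two_mul, Real.cos_two_mul] at h
  obtain ⟨h1, h2⟩ := h
  have hsc := Real.sin_sq_add_cos_sq φ
  have h0 : (x - c) * Real.sin φ - (y - c') * Real.cos φ = 0 := by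
    generalize Real.sin φ = s at *
    generalize Real.cos φ = t at *
    -- A reflection moves a point along the normal by twice its signed distance from the axis. `e1`
    -- and `e2` say, up to sign, that both components of half this displacement vanish.
    have e1 : s * ((x - c) * s - (y - c') * t) = 0 := by
      linear_combination -h1 / 2 + (x - c) * hsc
    have e2 : t * ((x - c) * s - (y - c') * t) = 0 := by linear_combination h2 / 2
    linear_combination s * e1 + t * e2 - ((x - c) * s - (y - c') * t) * hsc
  intro v hv
  rw [affinePoint, Projectivization.submodule_mk, Submodule.mem_span_singleton] at hv
  obtain ⟨t, rfl⟩ := hv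
  simp
  linear_combination t * h0

theorem exists_cos_sin {C S : ℝ} (h : C ^ 2 + S ^ 2 = 1) :
    ∃ θ : ℝ, Real.cos θ = C ∧ Real.sin θ = S := by
  have hn : ‖(⟨C, S⟩ : ℂ)‖ = 1 := by
    rw [Complex.norm_def, Complex.normSq_mk, ← sq, ← sq, h, Real.sqrt_one]
  have h1 := Complex.norm_mul_cos_arg ⟨C, S⟩
  have h2 := Complex.norm_mul_sin_arg ⟨C, S⟩
  rw [hn, one_mul] at h1 h2
  exact ⟨_, h1, h2⟩

theorem cos_sin_rotated_axis (φ : ℝ) :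
    (∀ k : Fin 4, Real.cos (2 * (φ + k * (Real.pi / 4))) =
      ![Real.cos (2 * φ), -Real.sin (2 * φ), -Real.cos (2 * φ), Real.sin (2 * φ)] k) ∧
    (∀ k : Fin 4, Real.sin (2 * (φ + k * (Real.pi / 4))) =
      ![Real.sin (2 * φ), Real.cos (2 * φ), -Real.sin (2 * φ), -Real.cos (2 * φ)] k) := by
  have h1 : 2 * (φ + Real.pi / 4) = 2 * φ + Real.pi / 2 := by ring
  have h2 : 2 * (φ + 2 * (Real.pi / 4)) = 2 * φ + Real.pi := by ring
  have h3 : 2 * (φ + 3 * (Real.pi / 4)) = 2 * φ + Real.pi + Real.pi / 2 := by ring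
  constructor <;> intro k <;> fin_cases k <;>
    simp [h1, h2, h3, Real.cos_add_pi_div_two, Real.sin_add_pi_div_two, Real.cos_add_pi,
      Real.sin_add_pi]

theorem isVertexSymmetryLine_of_smul {P : Octagon} {c c' φ : ℝ} (j : ZMod 8)
    (hP : ∀ i, ∃ x y, P i = affinePoint x y)
    (h : ∀ i, reflection c c' φ • P (j + i) = P (j - i)) : IsVertexSymmetryLine P c c' φ := by
  refine ⟨j, ?_, ?_, h⟩
  · have h0 := h 0
    obtain ⟨x, y, hxy⟩ := hP j
    rw [add_zero, sub_zero, hxy] at h0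
    rw [hxy]
    exact onAxis_of_reflection_smul h0
  · have h4 := h 4
    obtain ⟨x, y, hxy⟩ := hP (j + 4)
    have hj : ∀ j : ZMod 8, j - 4 = j + 4 := by decide
    rw [hj, hxy] at h4
    rw [hxy]
    exact onAxis_of_reflection_smul h4

theorem HasEuclideanParam.exists_vertexLines {P : Octagon} {c c' m n ε : ℝ} {x : ℝ × ℝ}
    (h : HasEuclideanParam P c c' m n ε x) (hx : x.1 = x.2) :
    ∃ φ, ∀ k : Fin 4, IsVertexSymmetryLine P c c' (φ + k * (Real.pi / 4)) := by
  obtain ⟨hmn, hε, h⟩ := h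
  -- `θ` is twice the argument of `m + i n`, so the axis at angle `θ / 2` passes through vertex 0.
  obtain ⟨θ, hC, hS⟩ := exists_cos_sin (C := (m ^ 2 - n ^ 2) / (m ^ 2 + n ^ 2))
    (S := 2 * m * n / (m ^ 2 + n ^ 2)) (by field_simp; ring)
  refine ⟨θ / 2, ?_⟩
  obtain ⟨hcos, hsin⟩ := cos_sin_rotated_axis (θ / 2)
  rw [mul_div_cancel₀ θ two_ne_zero, hC, hS] at hcos hsin
  have e1 : (m ^ 2 - n ^ 2) / (m ^ 2 + n ^ 2) * m + 2 * m * n / (m ^ 2 + n ^ 2) * n = m := by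
    field_simp; ring
  have e2 : 2 * m * n / (m ^ 2 + n ^ 2) * m - (m ^ 2 - n ^ 2) / (m ^ 2 + n ^ 2) * n = n := by
    field_simp; ring
  generalize (m ^ 2 - n ^ 2) / (m ^ 2 + n ^ 2) = C at *
  generalize 2 * m * n / (m ^ 2 + n ^ 2) = S at *
  obtain ⟨a, b⟩ := x
  obtain rfl : a = b := hx
  have e3 := congrArg (· * a) e1
  have e4 := congrArg (· * a) e2
  rcases hε with rfl | rfl
  -- Turning the axis by `π / 4` advances the reflected labeling by one vertex, forwards for `ε = 1`
  -- and backwards for `ε = -1`.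
  · refine fun k => isVertexSymmetryLine_of_smul (![0, 1, 2, 3] k) (fun i => ⟨_, _, h i⟩) ?_
    intro i
    rw [h, h, reflection_smul, hcos k, hsin k, affinePoint_inj]
    revert i
    fin_cases k <;> refine forall_zmod8 ?_ ?_ ?_ ?_ ?_ ?_ ?_ ?_ <;>
    · simp only [Fin.zero_eta, Fin.mk_one, Fin.reduceFinMk, cons_val]
      reduce_mod_char
      simp only [coordX_eq, coordY_eq]
      constructor <;> linarith
  · refine fun k => isVertexSymmetryLine_of_smul (![0, 7, 6, 5] k) (fun i => ⟨_, _, h i⟩) ?_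
    intro i
    rw [h, h, reflection_smul, hcos k, hsin k, affinePoint_inj]
    revert i
    fin_cases k <;> refine forall_zmod8 ?_ ?_ ?_ ?_ ?_ ?_ ?_ ?_ <;>
    · simp only [Fin.zero_eta, Fin.mk_one, Fin.reduceFinMk, cons_val]
      reduce_mod_char
      simp only [coordX_eq, coordY_eq]
      constructor <;> linarith

theorem HasEuclideanParam.exists_edgeLines {P : Octagon} {c c' m n ε : ℝ} {x : ℝ × ℝ}
    (h : HasEuclideanParam P c c' m n ε x) (hx : x.1 ^ 2 + x.2 ^ 2 = 1) :
    ∃ φ, ∀ k : Fin 4, IsEdgeSymmetryLine P c c' (φ + k * (Real.pi / 4)) := by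
  obtain ⟨hmn, hε, h⟩ := h
  obtain ⟨a, b⟩ := x
  simp only at hx h
  have hε2 : ε ^ 2 = 1 := by rcases hε with rfl | rfl <;> norm_num
  -- `C + i S` is `p₀ p₁ / |p₀|²`, with vertices taken relative to the center. The reflection `w ↦
  -- (C + i S) w̄` then takes `p₀` to `p₁`, and `|z| = 1` gives it unit modulus.
  obtain ⟨C, hC⟩ : ∃ C, C = (m * (m * a - ε * n * b) - n * (n * a + ε * m * b)) /
    (m ^ 2 + n ^ 2) := ⟨_, rfl⟩
  obtain ⟨S, hS⟩ : ∃ S, S = (m * (n * a + ε * m * b) + n * (m * a - ε * n * b)) /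
    (m ^ 2 + n ^ 2) := ⟨_, rfl⟩
  have e1 : C * m + S * n = m * a - ε * n * b := by
    rw [hC, hS]; field_simp; ring
  have e2 : S * m - C * n = n * a + ε * m * b := by
    rw [hC, hS]; field_simp; ring
  have hCS : C ^ 2 + S ^ 2 = 1 := by
    apply mul_left_cancel₀ hmn
    linear_combination (C * m + S * n + (m * a - ε * n * b)) * e1 +
      (S * m - C * n + (n * a + ε * m * b)) * e2 + (m ^ 2 + n ^ 2) * b ^ 2 * hε2 +
      (m ^ 2 + n ^ 2) * hx
  have e3 : C * (m * a - ε * n * b) + S * (n * a + ε * m * b) = m := by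
    linear_combination m * hCS - C * e1 - S * e2
  have e4 : S * (m * a - ε * n * b) - C * (n * a + ε * m * b) = n := by
    linear_combination n * hCS - S * e1 + C * e2
  clear hC hS
  obtain ⟨θ, rfl, rfl⟩ := exists_cos_sin hCS
  refine ⟨θ / 2, ?_⟩
  obtain ⟨hcos, hsin⟩ := cos_sin_rotated_axis (θ / 2)
  rw [mul_div_cancel₀ θ two_ne_zero] at hcos hsin
  generalize Real.cos θ = C at *
  generalize Real.sin θ = S at *
  rcases hε with rfl | rfl
  · refine fun k => ⟨![0, 1, 2, 3] k, fun i => ?_⟩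
    rw [h, h, reflection_smul, hcos k, hsin k, affinePoint_inj]
    revert i
    fin_cases k <;> refine forall_zmod8 ?_ ?_ ?_ ?_ ?_ ?_ ?_ ?_ <;>
    · simp only [Fin.zero_eta, Fin.mk_one, Fin.reduceFinMk, cons_val]
      reduce_mod_char
      simp only [coordX_eq, coordY_eq]
      constructor <;> linarith
  · refine fun k => ⟨![0, 7, 6, 5] k, fun i => ?_⟩
    rw [h, h, reflection_smul, hcos k, hsin k, affinePoint_inj]
    revert i
    fin_cases k <;> refine forall_zmod8 ?_ ?_ ?_ ?_ ?_ ?_ ?_ ?_ <;>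
    · simp only [Fin.zero_eta, Fin.mk_one, Fin.reduceFinMk, cons_val]
      reduce_mod_char
      simp only [coordX_eq, coordY_eq]
      constructor <;> linarith

/-! ### Regular octagons -/

theorem cos_sin_eighth_turns (i : ZMod 8) :
    Real.cos (i.val * (Real.pi / 4)) = coordX 1 0 (√2 / 2) (√2 / 2) i ∧
    Real.sin (i.val * (Real.pi / 4)) = coordY 1 0 (√2 / 2) (√2 / 2) i := by
  have e0 : ((0 : ZMod 8).val : ℝ) * (Real.pi / 4) = 0 := by
    rw [show (0 : ZMod 8).val = 0 from rfl]; push_cast; ring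
  have e1 : ((1 : ZMod 8).val : ℝ) * (Real.pi / 4) = Real.pi / 4 := by
    rw [show (1 : ZMod 8).val = 1 from rfl]; push_cast; ring
  have e2 : ((2 : ZMod 8).val : ℝ) * (Real.pi / 4) = Real.pi / 2 := by
    rw [show (2 : ZMod 8).val = 2 from rfl]; push_cast; ring
  have e3 : ((3 : ZMod 8).val : ℝ) * (Real.pi / 4) = Real.pi / 4 + Real.pi / 2 := by
    rw [show (3 : ZMod 8).val = 3 from rfl]; push_cast; ring
  have e4 : ((4 : ZMod 8).val : ℝ) * (Real.pi / 4) = Real.pi := by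
    rw [show (4 : ZMod 8).val = 4 from rfl]; push_cast; ring
  have e5 : ((5 : ZMod 8).val : ℝ) * (Real.pi / 4) = Real.pi / 4 + Real.pi := by
    rw [show (5 : ZMod 8).val = 5 from rfl]; push_cast; ring
  have e6 : ((6 : ZMod 8).val : ℝ) * (Real.pi / 4) = Real.pi / 2 + Real.pi := by
    rw [show (6 : ZMod 8).val = 6 from rfl]; push_cast; ring
  have e7 : ((7 : ZMod 8).val : ℝ) * (Real.pi / 4) = Real.pi / 4 + Real.pi / 2 + Real.pi := by
    rw [show (7 : ZMod 8).val = 7 from rfl]; push_cast; ring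
  revert i
  refine forall_zmod8 ?_ ?_ ?_ ?_ ?_ ?_ ?_ ?_ <;>
  · simp only [coordX_eq, coordY_eq, e0, e1, e2, e3, e4, e5, e6, e7]
    simp [Real.cos_add_pi_div_two, Real.sin_add_pi_div_two, Real.cos_add_pi, Real.sin_add_pi]

theorem regular_vertex (c c' r θ ε : ℝ) (hε : ε = 1 ∨ ε = -1) (i : ZMod 8) :
    affinePoint (c + r * Real.cos (θ + ε * (i.val * (Real.pi / 4))))
      (c' + r * Real.sin (θ + ε * (i.val * (Real.pi / 4)))) =
    affinePoint
      (r * Real.cos θ * coordX 1 0 (√2 / 2) (√2 / 2) i -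
        ε * (r * Real.sin θ) * coordY 1 0 (√2 / 2) (√2 / 2) i + c)
      (r * Real.sin θ * coordX 1 0 (√2 / 2) (√2 / 2) i +
        ε * (r * Real.cos θ) * coordY 1 0 (√2 / 2) (√2 / 2) i + c') := by
  rw [Real.cos_add, Real.sin_add, affinePoint_inj, ← (cos_sin_eighth_turns i).1,
    ← (cos_sin_eighth_turns i).2]
  rcases hε with rfl | rfl
  · simp only [one_mul]
    constructor <;> ring
  · simp only [neg_one_mul, Real.cos_neg, Real.sin_neg]
    constructor <;> ring

/-- Regularity is the single parameter `z = exp(iπ/4)`; radius and phase are the polar form of `m +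
i n`, and `ε` is the orientation. -/
theorem isRegular_iff {P : Octagon} :
    IsRegular P ↔ ∃ c c' m n ε, HasEuclideanParam P c c' m n ε (√2 / 2, √2 / 2) := by
  constructor
  · rintro ⟨c, c', r, θ, ε, hr, hε, h⟩
    refine ⟨c, c', r * Real.cos θ, r * Real.sin θ, ε, ?_, hε, fun i => ?_⟩
    · have : (r * Real.cos θ) ^ 2 + (r * Real.sin θ) ^ 2 = r ^ 2 := by
        linear_combination r ^ 2 * Real.sin_sq_add_cos_sq θ
      rw [this]
      positivity
    · rw [h, regular_vertex _ _ _ _ _ hε]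
  · rintro ⟨c, c', m, n, ε, hmn, hε, h⟩
    have hz : (⟨m, n⟩ : ℂ) ≠ 0 := by
      intro h0
      obtain ⟨hm, hn⟩ := Complex.ext_iff.1 h0
      simp at hm hn
      simp [hm, hn] at hmn
    have h1 := Complex.norm_mul_cos_arg ⟨m, n⟩
    have h2 := Complex.norm_mul_sin_arg ⟨m, n⟩
    refine ⟨c, c', ‖(⟨m, n⟩ : ℂ)‖, Complex.arg ⟨m, n⟩, ε, norm_pos_iff.2 hz, hε, fun i => ?_⟩
    rw [regular_vertex _ _ _ _ _ hε, h1, h2, h]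

theorem ConvexParam.eq_regular {x : ℝ × ℝ} (h : ConvexParam x) (h1 : x.1 = x.2)
    (h2 : x.1 ^ 2 + x.2 ^ 2 = 1) : x = (√2 / 2, √2 / 2) := by
  obtain ⟨a, b⟩ := x
  obtain rfl : a = b := h1
  simp only at h2
  have : a = √2 / 2 := by
    rw [eq_div_iff two_ne_zero, eq_comm, Real.sqrt_eq_iff_mul_self_eq_of_pos]
    · linarith
    · have := h.pos.1
      simp only at this
      positivity
  rw [← this]

theorem regular_convexParam : ConvexParam (√2 / 2, √2 / 2) := by
  have h : √2 * √2 = 2 := Real.mul_self_sqrt (by norm_num)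
  have h1 : 1 < √2 := by rw [Real.lt_sqrt] <;> norm_num
  constructor <;> simp only <;> nlinarith

end Pentagram

end

/-! ### The theorem -/

theorem theorem1 (P₀ : Pentagram.Octagon) (hP₀ : Pentagram.HasFourFoldSymmetry P₀) :
    (Pentagram.IsRegular P₀ ↔ ∀ j : ℤ, Pentagram.OrbitConvexAt P₀ j) ∧
    ((Pentagram.IsConvex P₀ ∧ Pentagram.HasVertexDihedralSymmetry P₀) ↔
      ∀ j : ℤ, 0 ≤ j → Pentagram.OrbitConvexAt P₀ j) ∧
    ((Pentagram.IsConvex P₀ ∧ Pentagram.HasEdgeDihedralSymmetry P₀) ↔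
      ∀ j : ℤ, j ≤ 0 → Pentagram.OrbitConvexAt P₀ j) := by
  obtain ⟨c, c', hs⟩ := hP₀
  refine ⟨⟨fun h => ?_, fun h => ?_⟩, ⟨fun ⟨hP, h⟩ => ?_, fun h => ?_⟩,
    ⟨fun ⟨hP, h⟩ => ?_, fun h => ?_⟩⟩
  · obtain ⟨d, d', m, n, ε, hE⟩ := Pentagram.isRegular_iff.1 h
    have hx := hE.hasParam
    have hP := (hx.isConvex Pentagram.regular_convexParam).isPositive
    intro j
    rcases le_total 0 j with hj | hj
    · exact (hx.forall_nonneg_convexAt_iff hP).2 rfl j hj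
    · refine (hx.forall_nonpos_convexAt_iff hP).2 ?_ j hj
      norm_num [div_pow]
  · have hP := (Pentagram.orbitConvexAt_zero.1 (h 0)).isPositive
    obtain ⟨m, n, ε, x, hE⟩ := Pentagram.exists_hasEuclideanParam hP hs
    have h1 := (hE.hasParam.forall_nonneg_convexAt_iff hP).1 fun j _ => h j
    have h2 := (hE.hasParam.forall_nonpos_convexAt_iff hP).1 fun j _ => h j
    rw [(hE.hasParam.convexParam hP).eq_regular h1 h2] at hE
    exact Pentagram.isRegular_iff.2 ⟨_, _, _, _, _, hE⟩
  · obtain ⟨m, n, ε, x, hE⟩ := Pentagram.exists_hasEuclideanParam hP.isPositive hs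
    obtain ⟨d, d', φ, -, hl⟩ := h
    -- One symmetry line suffices. Only distances enter, so the center `(d, d')` need not be
    -- compared with `(c, c')`.
    exact (hE.hasParam.forall_nonneg_convexAt_iff hP.isPositive).2 (hE.eq_of_vertexLine (hl 0))
  · have hP := Pentagram.orbitConvexAt_zero.1 (h 0 le_rfl)
    obtain ⟨m, n, ε, x, hE⟩ := Pentagram.exists_hasEuclideanParam hP.isPositive hs
    obtain ⟨φ, hφ⟩ := hE.exists_vertexLines
      ((hE.hasParam.forall_nonneg_convexAt_iff hP.isPositive).1 h)
    exact ⟨hP, c, c', φ, hs, hφ⟩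
  · obtain ⟨m, n, ε, x, hE⟩ := Pentagram.exists_hasEuclideanParam hP.isPositive hs
    obtain ⟨d, d', φ, -, hl⟩ := h
    exact (hE.hasParam.forall_nonpos_convexAt_iff hP.isPositive).2 (hE.eq_of_edgeLine (hl 0))
  · have hP := Pentagram.orbitConvexAt_zero.1 (h 0 le_rfl)
    obtain ⟨m, n, ε, x, hE⟩ := Pentagram.exists_hasEuclideanParam hP.isPositive hs
    obtain ⟨φ, hφ⟩ := hE.exists_edgeLines
      ((hE.hasParam.forall_nonpos_convexAt_iff hP.isPositive).1 h)
    exact ⟨hP, c, c', φ, hs, hφ⟩
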